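/- Let $R$ be a commutative artinian ring and $A$ an Artin $R$-algebra, that is, an $R$-algebra which is finitely generated as an $R$-module. Modules are finitely generated right modules unless said otherwise. Let $f\in A$ be an idempotent such that the left $A$-module $Af$ is projective, injective and minimal faithful (faithful, and isomorphic to a direct summand of every finitely generated faithful left $A$-module), and suppose that $A$ has dominant dimension at least two: in the minimal injective coresolution $0\to A\to I_0\to I_1\to\cdots$ of the regular right module $A$, the modules $I_0$ and $I_1$ are projective. Notation. Let $D=\operatorname{Hom}_R(-,J)$, with $J$ the injective envelope of $R/\operatorname{rad}R$, be the duality between right and left $A$-modules, and let $(-)^*=\operatorname{Hom}_A(-,A)$. For a left module $Y$ with minimal projective presentation $P_1\xrightarrow{g}P_0\to Y\to 0$ let $\operatorname{Tr}(Y)=\operatorname{coker}(g^*:P_0^*\to P_1^*)$. Put $\tau^{-1}=\operatorname{Tr}D$ and $\nu^{-1}=(-)^*D$, and let $\Omega^{-2}(X)$ be the second cosyzygy of $X$ in its minimal injective coresolution. A right $A$-module $X$ is called $\tau^{-1}$-perfect if $\tau^{-1}(X)\cong\nu^{-1}\Omega^{-2}(X)$ as right $A$-modules; $\operatorname{Per}_{\tau^{-1}}(A)$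 is the full subcategory of $\operatorname{mod-}A$ of the $\tau^{-1}$-perfect modules, and $\overline{\operatorname{Per}_{\tau^{-1}}(A)}$ is its costable category, in which maps are taken modulo those that factor through an injective module. Let $\operatorname{add}(Af)$ be the class of direct summands of finite direct sums of copies of the right $fAf$-module $Af$, and let $\operatorname{mod-}fAf/\operatorname{add}(Af)$ be the category of finitely generated right $fAf$-modules in which maps are taken modulo those that factor through a module in $\operatorname{add}(Af)$. Then there is an equivalence of categories $$\operatorname{mod-}fAf/\operatorname{add}(Af)\;\simeq\;\overline{\operatorname{Per}_{\tau^{-1}}(A)}.$$ -/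

import Mathlib

open CategoryTheory MulOpposite

universe u v

noncomputable section

namespace ArtinAlg

/-! ### Injective envelopes -/

section InjectiveEnvelope

variable (B : Type u) [Ring B]

/-- `i : M → E` is an injective envelope: `E` is injective, `i` is injective and its image is an
essential submodule of `E`. -/
structure IsInjectiveEnvelope {M E : Type u} [AddCommGroup M] [Module B M]
    [AddCommGroup E] [Module B E] (i : M →ₗ[B] E) : Prop where
  injective_module : Module.Injective B E
  injective : Function.Injective i
  essential : ∀ K : Submodule B E, K ⊓ LinearMap.range i = ⊥ → K = ⊥

variable {B} in
/-- Every submodule of an injective module has an injective envelope inside that module. -/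
theorem exists_envelope_within {Q : Type u} [AddCommGroup Q] [Module B Q]
    (hQ : Module.Injective B Q) (M : Submodule B Q) :
    ∃ N : Submodule B Q, M ≤ N ∧ Module.Injective B N ∧
      ∀ K : Submodule B Q, K ≤ N → K ⊓ M = ⊥ → K = ⊥ := by
  obtain ⟨N, hMN, hN⟩ := zorn_le_nonempty₀
    {N : Submodule B Q | ∀ K : Submodule B Q, K ≤ N → K ⊓ M = ⊥ → K = ⊥}
    (fun c hc hchain y hy ↦ by
      refine ⟨sSup c, ?_, fun z hz ↦ le_sSup hz⟩
      intro K hK hKM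
      rw [Submodule.eq_bot_iff]
      intro x hx
      obtain ⟨L, hL, hxL⟩ :=
        (Submodule.mem_sSup_of_directed ⟨y, hy⟩ hchain.directedOn).1 (hK hx)
      have h1 : Submodule.span B {x} = ⊥ := by
        refine hc hL _ ?_ ?_
        · rwa [Submodule.span_singleton_le_iff_mem]
        · refine le_bot_iff.1 (le_trans (inf_le_inf_right M ?_) hKM.le)
          rwa [Submodule.span_singleton_le_iff_mem]
      simpa using h1) M (fun K hK h ↦ by rwa [inf_eq_left.2 hK] at h)
  have hNe := hN.prop
  obtain ⟨K, -, hK⟩ := zorn_le_nonempty₀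
    {K : Submodule B Q | K ⊓ N = ⊥}
    (fun c hc hchain y hy ↦ by
      refine ⟨sSup c, ?_, fun z hz ↦ le_sSup hz⟩
      change sSup c ⊓ N = ⊥
      rw [Submodule.eq_bot_iff]
      rintro x ⟨hx, hxN⟩
      obtain ⟨L, hL, hxL⟩ :=
        (Submodule.mem_sSup_of_directed ⟨y, hy⟩ hchain.directedOn).1 hx
      have : x ∈ L ⊓ N := ⟨hxL, hxN⟩
      rw [show L ⊓ N = ⊥ from hc hL] at this
      simpa using this) ⊥ (bot_inf_eq N)
  have hKN : K ⊓ N = ⊥ := hK.prop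
  let j : N →ₗ[B] Q ⧸ K := K.mkQ ∘ₗ N.subtype
  have hj : Function.Injective j := by
    rw [← LinearMap.ker_eq_bot, Submodule.eq_bot_iff]
    intro x hx
    have hxK : (x : Q) ∈ K := by simpa [j] using hx
    have : (x : Q) ∈ K ⊓ N := ⟨hxK, x.2⟩
    rw [hKN] at this
    simpa using this
  obtain ⟨h, hh⟩ := hQ.out j hj N.subtype
  have hhN : ∀ x (hx : x ∈ N), h (K.mkQ x) = x := fun x hx ↦ hh ⟨x, hx⟩
  have hinj : LinearMap.ker h = ⊥ := by
    have h2 : K = (LinearMap.ker h).comap K.mkQ := by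
      refine hK.eq_of_le ?_ ?_
      · change _ ⊓ N = ⊥
        rw [Submodule.eq_bot_iff]
        rintro x ⟨hx, hxN⟩
        have : h (K.mkQ x) = 0 := by simpa using hx
        rwa [hhN x hxN] at this
      · intro x hx
        have : K.mkQ x = 0 := by simpa using hx
        simp only [Submodule.mem_comap, LinearMap.mem_ker]
        rw [this, map_zero]
    rw [Submodule.eq_bot_iff]
    intro y hy
    obtain ⟨x, rfl⟩ := K.mkQ_surjective y
    have : x ∈ (LinearMap.ker h).comap K.mkQ := hy
    rw [← h2] at this
    simpa using this
  have hrange : N = LinearMap.range h := by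
    refine hN.eq_of_le ?_ ?_
    · intro L hL hLM
      have hLN : L ⊓ N = ⊥ := hNe _ inf_le_right (by
        refine le_bot_iff.1 (le_trans ?_ hLM.le)
        exact inf_le_inf_right M inf_le_left)
      have h3 : K = (L.comap h).comap K.mkQ := by
        refine hK.eq_of_le ?_ ?_
        · change _ ⊓ N = ⊥
          rw [Submodule.eq_bot_iff]
          rintro x ⟨hx, hxN⟩
          have h4 : h (K.mkQ x) ∈ L := hx
          rw [hhN x hxN] at h4
          have : x ∈ L ⊓ N := ⟨h4, hxN⟩
          rw [hLN] at this
          simpa using this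
        · intro x hx
          have : K.mkQ x = 0 := by simpa using hx
          simp only [Submodule.mem_comap]
          rw [this, map_zero]
          exact L.zero_mem
      rw [Submodule.eq_bot_iff]
      intro y hy
      obtain ⟨z, rfl⟩ := hL hy
      obtain ⟨x, rfl⟩ := K.mkQ_surjective z
      have : x ∈ (L.comap h).comap K.mkQ := hy
      rw [← h3] at this
      have : K.mkQ x = 0 := by simpa using this
      rw [this, map_zero]
    · intro x hx
      exact ⟨K.mkQ x, hhN x hx⟩
  refine ⟨N, hMN, ⟨fun X Y _ _ _ _ f hf g ↦ ?_⟩, hNe⟩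
  obtain ⟨e, he⟩ := hQ.out f hf (N.subtype ∘ₗ g)
  refine ⟨(h ∘ₗ K.mkQ ∘ₗ e).codRestrict N (fun y ↦ ?_), fun x ↦ ?_⟩
  · rw [hrange]
    exact ⟨_, rfl⟩
  · apply Subtype.ext
    change h (K.mkQ (e (f x))) = _
    rw [he]
    exact hhN _ (g x).2

/-- Every module has an injective envelope. -/
theorem exists_injectiveEnvelope (M : Type u) [AddCommGroup M] [Module B M] :
    ∃ (E : ModuleCat.{u} B) (i : M →ₗ[B] E), IsInjectiveEnvelope B i := by
  obtain ⟨J⟩ := (inferInstance : EnoughInjectives (ModuleCat.{u} B)).presentation (ModuleCat.of B M)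
  let Q : ModuleCat.{u} B := J.J
  have hQ : Module.Injective B Q :=
    haveI : CategoryTheory.Injective (ModuleCat.of B Q) := J.injective
    Module.injective_module_of_injective_object B Q
  let f : M →ₗ[B] Q := J.f.hom
  have hf : Function.Injective f := (ModuleCat.mono_iff_injective J.f).1 J.mono
  obtain ⟨N, hMN, hinj, hess⟩ := exists_envelope_within hQ (LinearMap.range f)
  refine ⟨ModuleCat.of B N, f.codRestrict N (fun x ↦ hMN ⟨x, rfl⟩), hinj, ?_, ?_⟩
  · intro x y hxy
    exact hf (congrArg Subtype.val hxy)
  · intro (K : Submodule B N) hK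
    have h1 : K.map N.subtype = ⊥ := by
      refine hess _ (Submodule.map_subtype_le N K) ?_
      rw [Submodule.eq_bot_iff]
      rintro _ ⟨⟨y, hy, rfl⟩, ⟨x, hx⟩⟩
      have h2 : y ∈ K ⊓ LinearMap.range (f.codRestrict N (fun x ↦ hMN ⟨x, rfl⟩)) :=
        ⟨hy, ⟨x, Subtype.ext hx⟩⟩
      have h3 : y ∈ (⊥ : Submodule B N) := hK ▸ h2
      rw [Submodule.mem_bot] at h3
      rw [h3, map_zero]
    exact Submodule.map_injective_of_injective N.injective_subtype
      (h1.trans (Submodule.map_bot _).symm)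

/-- The injective envelope `E(M)` of a module `M`. -/
def injectiveEnvelope (M : Type u) [AddCommGroup M] [Module B M] : ModuleCat.{u} B :=
  (exists_injectiveEnvelope B M).choose

/-- The embedding `M → E(M)`. -/
def toInjectiveEnvelope (M : Type u) [AddCommGroup M] [Module B M] :
    M →ₗ[B] injectiveEnvelope B M :=
  (exists_injectiveEnvelope B M).choose_spec.choose

theorem isInjectiveEnvelope_toInjectiveEnvelope (M : Type u) [AddCommGroup M] [Module B M] :
    IsInjectiveEnvelope B (toInjectiveEnvelope B M) :=
  (exists_injectiveEnvelope B M).choose_spec.choose_spec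

/-- The cosyzygies `Ω⁻ⁿ(M)`: `Ω⁰(M) = M` and `Ω⁻⁽ⁿ⁺¹⁾(M)` is the cokernel of
`Ω⁻ⁿ(M) → E(Ω⁻ⁿ(M))`. -/
def cosyzygy (M : Type u) [AddCommGroup M] [Module B M] : ℕ → ModuleCat.{u} B
  | 0 => ModuleCat.of B M
  | n + 1 => ModuleCat.of B (injectiveEnvelope B (cosyzygy M n) ⧸
      LinearMap.range (toInjectiveEnvelope B (cosyzygy M n)))

/-- The `n`-th term `Iₙ = E(Ω⁻ⁿ(M))` of the minimal injective coresolution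
`0 → M → I₀ → I₁ → ⋯`. -/
def minimalInjectiveTerm (M : Type u) [AddCommGroup M] [Module B M] (n : ℕ) : ModuleCat.{u} B :=
  injectiveEnvelope B (cosyzygy B M n)

/-- The dominant dimension of `M`: the smallest `k` such that `Iₖ` is not projective
(`⊤` if there is none). -/
def dominantDimension (M : Type u) [AddCommGroup M] [Module B M] : ℕ∞ :=
  sInf {k : ℕ∞ | ∃ n : ℕ, k = n ∧ ¬ Module.Projective B (minimalInjectiveTerm B M n)}

end InjectiveEnvelope

/-! ### Direct summands and minimal faithful modules -/

/-- `M` is isomorphic to a direct summand of `N`. -/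
def IsDirectSummandOf (B : Type u) [Ring B] (M N : Type u) [AddCommGroup M] [Module B M]
    [AddCommGroup N] [Module B N] : Prop :=
  ∃ (i : M →ₗ[B] N) (r : N →ₗ[B] M), r ∘ₗ i = LinearMap.id

/-- `M` is a minimal faithful module: it is faithful and isomorphic to a direct summand of every
finitely generated faithful module. -/
def IsMinimalFaithful (B : Type u) [Ring B] (M : Type u) [AddCommGroup M] [Module B M] : Prop :=
  FaithfulSMul B M ∧
    ∀ (N : Type u) [AddCommGroup N] [Module B N] [Module.Finite B N] [FaithfulSMul B N],
      IsDirectSummandOf B M N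

/-! ### Duality, `A`-dual, transpose, `τ⁻¹`

Right `A`-modules are modules over `Aᵐᵒᵖ`, with `x · a = op a • x`. -/

section Functors

variable (R : Type u) [CommRing R] (A : Type u) [Ring A] [Algebra R A]

/-- The module `J`: the injective envelope of `R / rad R`. -/
abbrev dualizingModule : Type u := injectiveEnvelope R (R ⧸ Ring.jacobson R)

/-- The subgroup of `R`-linear maps `X → J`, where `R` acts on the right `A`-module `X` through
`R → A`. -/
def artinDualSubgroup (X : Type u) [AddCommGroup X] [Module Aᵐᵒᵖ X] :
    AddSubgroup (X →+ dualizingModule R) where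
  carrier := {φ | ∀ (r : R) (x : X), φ (op (algebraMap R A r) • x) = r • φ x}
  add_mem' {φ ψ} hφ hψ r x := by
    rw [AddMonoidHom.add_apply, AddMonoidHom.add_apply, hφ r x, hψ r x, smul_add]
  zero_mem' r x := (smul_zero r).symm
  neg_mem' {φ} hφ r x := by
    rw [AddMonoidHom.neg_apply, AddMonoidHom.neg_apply, hφ r x, smul_neg]

/-- The duality `D(X) = Hom_R(X, J)` on right `A`-modules. -/
abbrev ArtinDual (X : Type u) [AddCommGroup X] [Module Aᵐᵒᵖ X] : Type u := artinDualSubgroup R A X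

/-- `D(X)` is a left `A`-module via `(a • φ)(x) = φ(x · a)`. -/
instance (X : Type u) [AddCommGroup X] [Module Aᵐᵒᵖ X] : Module A (ArtinDual R A X) where
  smul a φ := ⟨φ.1.comp (DistribSMul.toAddMonoidHom X (op a)), fun r x ↦ by
    change φ.1 (op a • op (algebraMap R A r) • x) = r • φ.1 (op a • x)
    rw [← φ.2, smul_smul, smul_smul, ← op_mul, ← op_mul, Algebra.commutes]⟩
  one_smul φ := Subtype.ext <| AddMonoidHom.ext fun x ↦ congrArg φ.1 (one_smul Aᵐᵒᵖ x)
  mul_smul a b φ := Subtype.ext <| AddMonoidHom.ext fun x ↦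
    congrArg φ.1 (mul_smul (op b) (op a) x)
  smul_zero _ := rfl
  smul_add _ _ _ := rfl
  add_smul a b φ := Subtype.ext <| AddMonoidHom.ext fun x ↦
    (congrArg φ.1 (add_smul (op a) (op b) x)).trans (map_add φ.1 _ _)
  zero_smul φ := Subtype.ext <| AddMonoidHom.ext fun x ↦
    (congrArg φ.1 (zero_smul Aᵐᵒᵖ x)).trans (map_zero φ.1)

theorem ArtinDual.smul_apply (X : Type u) [AddCommGroup X] [Module Aᵐᵒᵖ X] (a : A)
    (φ : ArtinDual R A X) (x : X) : (a • φ).1 x = φ.1 (op a • x) := rfl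

/-- The dual `Y* = Hom_A(Y, A)` of a left `A`-module, a right `A`-module via
`(φ · a)(y) = φ(y) a`. -/
abbrev Star (Y : Type u) [AddCommGroup Y] [Module A Y] : Type u := Y →ₗ[A] A

variable {A} in
/-- The map `g* : P* → Q*`, `φ ↦ φ ∘ g`, for `g : Q → P`. -/
def starMap {Q P : Type u} [AddCommGroup Q] [Module A Q] [AddCommGroup P] [Module A P]
    (g : Q →ₗ[A] P) : Star A P →ₗ[Aᵐᵒᵖ] Star A Q where
  toFun φ := φ ∘ₗ g
  map_add' _ _ := rfl
  map_smul' _ _ := rfl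

/-- `p : P → Y` is a projective cover: `P` is finitely generated projective, `p` is surjective and
its kernel is a superfluous submodule of `P`. -/
structure IsProjectiveCover {P Y : Type u} [AddCommGroup P] [Module A P]
    [AddCommGroup Y] [Module A Y] (p : P →ₗ[A] Y) : Prop where
  finite : Module.Finite A P
  projective : Module.Projective A P
  surjective : Function.Surjective p
  superfluous : ∀ K : Submodule A P, K ⊔ LinearMap.ker p = ⊤ → K = ⊤

/-- `P₁ → P₀ → Y → 0` is a minimal projective presentation: `P₀ → Y` and `P₁ → ker (P₀ → Y)` are
projective covers. -/
structure IsMinimalProjectivePresentation {P₁ P₀ Y : Type u} [AddCommGroup P₁] [Module A P₁]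
    [AddCommGroup P₀] [Module A P₀] [AddCommGroup Y] [Module A Y]
    (g : P₁ →ₗ[A] P₀) (p : P₀ →ₗ[A] Y) : Prop where
  cover : IsProjectiveCover A p
  comp_eq_zero : ∀ x, g x ∈ LinearMap.ker p
  cover_ker : IsProjectiveCover A (g.codRestrict (LinearMap.ker p) comp_eq_zero)

/-- `T ≅ Tr(Y)`: the right module `T` is isomorphic to the cokernel of `g* : P₀* → P₁*` for a
minimal projective presentation `P₁ → P₀ → Y → 0` of the left module `Y`. -/
def IsTranspose (Y : Type u) [AddCommGroup Y] [Module A Y]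
    (T : Type u) [AddCommGroup T] [Module Aᵐᵒᵖ T] : Prop :=
  ∃ (P₁ P₀ : ModuleCat.{u} A) (g : P₁ →ₗ[A] P₀) (p : P₀ →ₗ[A] Y),
    IsMinimalProjectivePresentation A g p ∧
      Nonempty (T ≃ₗ[Aᵐᵒᵖ] (Star A P₁ ⧸ LinearMap.range (starMap g)))

/-- `T ≅ τ⁻¹(X)`, where `τ⁻¹ = Tr D`. -/
def IsTauInv (X : Type u) [AddCommGroup X] [Module Aᵐᵒᵖ X]
    (T : Type u) [AddCommGroup T] [Module Aᵐᵒᵖ T] : Prop :=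
  IsTranspose A (ArtinDual R A X) T

/-- The inverse Nakayama functor `ν⁻¹(X) = D(X)*` on right modules. -/
abbrev NuInv (X : Type u) [AddCommGroup X] [Module Aᵐᵒᵖ X] : Type u := Star A (ArtinDual R A X)

/-- `X` is `τ⁻¹`-perfect: `τ⁻¹(X) ≅ ν⁻¹ Ω⁻²(X)`. -/
def IsTauInvPerfect (X : Type u) [AddCommGroup X] [Module Aᵐᵒᵖ X] : Prop :=
  IsTauInv R A X (NuInv R A (cosyzygy Aᵐᵒᵖ X 2))

/-- `Per_{τ⁻¹}(A)`, as a class of objects of `mod-A`. -/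
def perTauInv : ObjectProperty (FGModuleCat.{u} Aᵐᵒᵖ) := fun X ↦ IsTauInvPerfect R A X

end Functors

/-! ### Quotient categories -/

/-- Two maps are related if their difference factors through an object satisfying `P`. -/
def factorsThrough {C : Type v} [Category.{u} C] [Preadditive C] (P : ObjectProperty C) :
    HomRel C :=
  fun X Y f g ↦ ∃ (Z : C) (a : X ⟶ Z) (b : Z ⟶ Y), P Z ∧ f - g = a ≫ b

/-- The category `C` modulo the maps that factor through an object satisfying `P`. -/
abbrev ModuloObjects (C : Type v) [Category.{u} C] [Preadditive C] (P : ObjectProperty C) :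
    Type v :=
  CategoryTheory.Quotient (factorsThrough P)

/-- The maps of a full subcategory `𝒞` of `mod-B` that agree up to a map factoring through an
injective module in `mod-B`. -/
def factorsThroughInjective (B : Type u) [Ring B] (𝒞 : ObjectProperty (FGModuleCat.{u} B)) :
    HomRel 𝒞.FullSubcategory :=
  fun _ _ f g ↦
    factorsThrough (fun Z : FGModuleCat.{u} B ↦ Module.Injective B Z) (𝒞.ι.map f) (𝒞.ι.map g)

/-- The costable category of a full subcategory `𝒞` of the category of finitely generated
modules: `𝒞` modulo the maps that factor through an injective module. -/
abbrev CostableCategory (B : Type u) [Ring B] (𝒞 : ObjectProperty (FGModuleCat.{u} B)) :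
    Type (u + 1) :=
  CategoryTheory.Quotient (factorsThroughInjective B 𝒞)

/-- `add(M)`: the finitely generated modules that are direct summands of some `Mⁿ`. -/
def addClosure (B : Type u) [Ring B] (M : Type u) [AddCommGroup M] [Module B M] :
    ObjectProperty (FGModuleCat.{u} B) :=
  fun N ↦ ∃ n : ℕ, IsDirectSummandOf B N (Fin n → M)

/-! ### The bimodule `Af` -/

section Corner

variable {A : Type u} [Ring A] (f : A)

/-- The left ideal `Af`, a left `A`-module. -/
abbrev LeftIdealOf : Type u := Ideal.span {f}

variable {f}

theorem mul_corner_mem (hf : IsIdempotentElem f) (x : LeftIdealOf f) (c : hf.Corner) :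
    (x : A) * c.1 ∈ Ideal.span {f} := by
  refine Ideal.mem_span_singleton'.2 ⟨(x : A) * c.1, ?_⟩
  rw [mul_assoc, ((Subsemigroup.mem_corner_iff hf).1 c.2).2]

theorem mul_idem_eq (hf : IsIdempotentElem f) (x : LeftIdealOf f) : (x : A) * f = x := by
  obtain ⟨a, ha⟩ := Ideal.mem_span_singleton'.1 x.2
  rw [← ha, mul_assoc, hf.eq]

/-- `Af` is a right module over `fAf` by multiplication in `A`. -/
instance (hf : IsIdempotentElem f) : Module (hf.Corner)ᵐᵒᵖ (LeftIdealOf f) where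
  smul c x := ⟨(x : A) * c.unop.1, mul_corner_mem hf x c.unop⟩
  one_smul x := Subtype.ext (mul_idem_eq hf x)
  mul_smul c d x := Subtype.ext (mul_assoc (x : A) d.unop.1 c.unop.1).symm
  smul_zero c := Subtype.ext (zero_mul c.unop.1)
  smul_add c x y := Subtype.ext (add_mul (x : A) (y : A) c.unop.1)
  add_smul c d x := Subtype.ext (mul_add (x : A) c.unop.1 d.unop.1)
  zero_smul x := Subtype.ext (mul_zero (x : A))

end Corner

end ArtinAlg

end

/-!
Write `M = Af` and call a right `A`-module `T` corner-closed if the natural map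
`T → Hom_{fAf}(M, Tf)` is bijective. The equivalence is obtained by comparing both sides with one
category of presentations (`ClosedPresentation`): its objects are the maps `g : P₁ → P₀` of finitely
generated projective left modules for which `T(g) = coker(g* : P₀* → P₁*)` is corner-closed, and its
maps are commutative squares. There are two functors,
`toCornerModule : g ↦ T(g) f` to right `fAf`-modules and `toPerfect : g ↦ D'(coker g)` to
`τ⁻¹`-perfect modules, where `D'` is the duality inverse to `D` (`LeftDual`). Both are full and
essentially surjective onto the respective quotient categories, and they identify the same maps, so
their targets are equivalent (`nonempty_equivalence_of_map_eq_iff`).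

That the same maps are identified is `cokerMap_factor_iff`: a square `(a₁, a₀)` becomes zero on
either side if and only if `a₀ g' = g s g'` for some `s`. Indeed a map of cokernels which factors
through a projective module (after `D'`, through an injective module; on corner parts, through
`add(Af)`) factors through the projective module that the presentation puts over its target.

The hypotheses on `f` and `A` enter as follows.
* `A` itself is corner-closed, that is, `A = End_{fAf}(M)` (`isCornerClosed_self`). Here `M` is
  faithful and projective, and `I₁` is projective. Hence the dual `W*` of every left module `W` is
  corner-closed (`isCornerClosed_star`).
* If `X` is perfect, then `T(g) ≅ τ⁻¹ X ≅ (D Ω⁻² X)*` for the minimal presentation `g` of `D X`, so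
  `T(g)` is corner-closed and `g` is an object of the category of presentations.
* Conversely, whether `T(g)` is corner-closed depends only on `coker g`
  (`IsCornerClosed.of_presentation`). So if `D X` has some presentation with corner-closed `T(g)`,
  then this holds for the minimal one, which is the dual `D I₁ → D I₀` of the minimal injective
  copresentation of `X`. Its kernel `K` is `D Ω⁻² X`, and `T(g) → K*` is bijective since it is a map
  of corner-closed modules which is bijective on corner parts, as `Hom_A(-, M)` is exact
  (`nonempty_cokerStar_equiv`). Thus `τ⁻¹ X ≅ ν⁻¹ Ω⁻² X`.

The duality between finitely generated left and right modules rests on Matlis duality over `R`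
(`exists_eval_eq`), proved by comparing lengths.
-/

noncomputable section

namespace ArtinAlg

/-! ### Matlis duality over a commutative artinian ring -/

section Matlis

variable (R : Type u) [CommRing R]

theorem injective_dualizingModule : Module.Injective R (dualizingModule R) :=
  (isInjectiveEnvelope_toInjectiveEnvelope R (R ⧸ Ring.jacobson R)).injective_module

variable {R}

theorem exists_extend_dualizing {X Y : Type u} [AddCommGroup X] [Module R X]
    [AddCommGroup Y] [Module R Y] (i : X →ₗ[R] Y) (hi : Function.Injective i)
    (φ : X →ₗ[R] dualizingModule R) : ∃ ψ : Y →ₗ[R] dualizingModule R, ψ ∘ₗ i = φ := by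
  obtain ⟨ψ, h⟩ := (injective_dualizingModule R).out i hi φ
  exact ⟨ψ, LinearMap.ext h⟩

/-- An element of a maximal ideal `m` that is killed by `m` modulo the radical lies in the
radical. -/
theorem mem_jacobson_of_mul_mem (m : Ideal R) [m.IsMaximal] {y : R} (hy : y ∈ m)
    (h : ∀ r ∈ m, r * y ∈ Ring.jacobson R) : y ∈ Ring.jacobson R := by
  rw [Ring.jacobson_eq_sInf_isMaximal]
  refine Submodule.mem_sInf.2 fun (m' : Ideal R) (hm' : m'.IsMaximal) ↦ ?_
  by_cases hmm : m ≤ m'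
  · exact hmm hy
  · obtain ⟨r, hr, hrm⟩ := Set.not_subset.1 hmm
    have h1 := h r hr
    rw [Ring.jacobson_eq_sInf_isMaximal] at h1
    exact (hm'.isPrime.mem_or_mem ((Submodule.mem_sInf.1 h1) m' hm')).resolve_left hrm

/-- The dual of a simple module has length at most one, because the socle of `J` is `R / rad R`. -/
theorem length_dual_le_one (S : Type u) [AddCommGroup S] [Module R S] [IsSimpleModule R S] :
    Module.length R (S →ₗ[R] dualizingModule R) ≤ 1 := by
  rcases subsingleton_or_nontrivial (S →ₗ[R] dualizingModule R) with h | h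
  · rw [Module.length_eq_zero]
    exact zero_le_one
  have := IsSimpleModule.nontrivial R S
  obtain ⟨s, hs⟩ := exists_ne (0 : S)
  have hgen : ∀ z : S, ∃ r : R, r • s = z := fun z ↦
    IsSimpleModule.toSpanSingleton_surjective R hs z
  let m : Ideal R := LinearMap.ker (LinearMap.toSpanSingleton R S s)
  have hm : m.IsMaximal := IsSimpleModule.ker_toSpanSingleton_isMaximal R hs
  have hms : ∀ r, r ∈ m ↔ r • s = 0 := fun r ↦ by simp [m]
  have hinv : ∀ r, r ∉ m → ∃ r', r' * r - 1 ∈ m := fun r hr ↦ by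
    obtain ⟨r', h'⟩ := hm.exists_inv hr
    obtain ⟨i, hi, h''⟩ := h'
    exact ⟨r', by rw [← h'']; simpa using hi⟩
  let ι := toInjectiveEnvelope R (R ⧸ Ring.jacobson R)
  have hι := isInjectiveEnvelope_toInjectiveEnvelope R (R ⧸ Ring.jacobson R)
  have hval : ∀ φ : S →ₗ[R] dualizingModule R, ∃ y : R,
      φ s = ι (Submodule.Quotient.mk y) ∧ ∀ r ∈ m, r * y ∈ Ring.jacobson R := by
    intro φ
    have h1 : φ s ∈ LinearMap.range ι := by
      by_contra hn
      have h2 : Submodule.span R {φ s} = ⊥ := by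
        refine hι.essential _ ?_
        rw [Submodule.eq_bot_iff]
        rintro z ⟨hz, hz'⟩
        obtain ⟨r, rfl⟩ := Submodule.mem_span_singleton.1 hz
        by_cases hr : r ∈ m
        · rw [← map_smul, (hms r).1 hr, map_zero]
        · obtain ⟨r', hr'⟩ := hinv r hr
          refine (hn ?_).elim
          have h3 : φ s = r' • r • φ s := by
            have h4 := (hms _).1 hr'
            rw [sub_smul, one_smul, sub_eq_zero] at h4
            rw [smul_smul, ← map_smul, h4]
          rw [h3]
          exact Submodule.smul_mem _ _ hz'
      rw [Submodule.span_singleton_eq_bot] at h2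
      exact hn (h2 ▸ Submodule.zero_mem _)
    obtain ⟨yb, hy⟩ := h1
    obtain ⟨y, rfl⟩ := Submodule.Quotient.mk_surjective _ yb
    refine ⟨y, hy.symm, fun r hr ↦ ?_⟩
    have h5 : ι (Submodule.Quotient.mk (r • y)) = 0 := by
      rw [Submodule.Quotient.mk_smul, map_smul, hy, ← map_smul, (hms r).1 hr, map_zero]
    exact (Submodule.Quotient.mk_eq_zero _).1 (hι.injective (h5.trans (map_zero _).symm))
  have : IsSimpleModule R (S →ₗ[R] dualizingModule R) := by
    rw [isSimpleModule_iff_toSpanSingleton_surjective]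
    refine ⟨h, fun φ hφ ψ ↦ ?_⟩
    obtain ⟨y, hy, hmy⟩ := hval φ
    obtain ⟨z, hz, hmz⟩ := hval ψ
    have hym : y ∉ m := fun hym ↦ hφ <| by
      have h6 := mem_jacobson_of_mul_mem m hym hmy
      ext t
      obtain ⟨r, rfl⟩ := hgen t
      rw [map_smul, hy, (Submodule.Quotient.mk_eq_zero _).2 h6, map_zero, smul_zero,
        LinearMap.zero_apply]
    obtain ⟨y', hy'⟩ := hinv y hym
    have h7 : z - z * y' * y ∈ Ring.jacobson R := by
      refine mem_jacobson_of_mul_mem m ?_ fun r hr ↦ ?_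
      · have : z - z * y' * y = -z * (y' * y - 1) := by ring
        rw [this]
        exact m.mul_mem_left _ hy'
      · have : r * (z - z * y' * y) = r * z - z * y' * (r * y) := by ring
        rw [this]
        exact sub_mem (hmz r hr) (Ideal.mul_mem_left _ _ (hmy r hr))
    refine ⟨z * y', ?_⟩
    ext t
    obtain ⟨r, rfl⟩ := hgen t
    have h8 : ψ s = (z * y') • φ s := by
      rw [hy, hz, ← map_smul, ← Submodule.Quotient.mk_smul]
      exact congrArg ι ((Submodule.Quotient.eq _).2 h7)
    rw [map_smul ψ, h8, LinearMap.toSpanSingleton_apply, LinearMap.smul_apply, map_smul φ,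
      smul_comm]
  rw [Module.length_eq_one]

theorem length_dual_le {X : Type u} [AddCommGroup X] [Module R X] (hX : IsFiniteLength R X) :
    Module.length R (X →ₗ[R] dualizingModule R) ≤ Module.length R X := by
  induction hX with
  | of_subsingleton =>
    rw [Module.length_eq_zero]
    exact zero_le
  | @of_simple_quotient M _ _ N _ _ ih =>
    rw [Module.length_eq_add_of_exact N.subtype N.mkQ N.injective_subtype N.mkQ_surjective
      (LinearMap.exact_subtype_mkQ N)]
    rw [Module.length_eq_add_of_exact (M := M →ₗ[R] dualizingModule R)
      (N := (M ⧸ N) →ₗ[R] dualizingModule R) (P := N →ₗ[R] dualizingModule R)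
      (LinearMap.lcomp R _ N.mkQ) (LinearMap.lcomp R _ N.subtype)
      (fun φ ψ h ↦ by
        ext x
        exact LinearMap.congr_fun h x)
      (fun φ ↦ exists_extend_dualizing N.subtype N.injective_subtype φ)
      (fun φ ↦ ⟨fun h ↦ ⟨N.liftQ φ fun x hx ↦ LinearMap.congr_fun h ⟨x, hx⟩, by ext; rfl⟩, by
        rintro ⟨ψ, rfl⟩
        ext x
        change ψ (N.mkQ x) = 0
        rw [show N.mkQ x = 0 from (Submodule.Quotient.mk_eq_zero N).2 x.2, map_zero]⟩), add_comm]
    refine add_le_add ih ((length_dual_le_one _).trans ?_)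
    rw [Module.length_eq_one]

variable [IsArtinianRing R]

/-- The residue field at a maximal ideal `m` embeds into `R / rad R`: an element lying in all
other maximal ideals but not in `m` spans a copy of it. -/
theorem exists_notMem_jacobson (m : Ideal R) [hm : m.IsMaximal] :
    ∃ y : R, y ∉ Ring.jacobson R ∧ ∀ r ∈ m, r * y ∈ Ring.jacobson R := by
  classical
  have hfin := IsArtinianRing.setOfPred_isMaximal_finite R
  let s : Finset (Ideal R) := hfin.toFinset.erase m
  have h : ¬ s.inf id ≤ m := by
    intro h
    obtain ⟨m', hm', hle⟩ := (Ideal.IsPrime.inf_le' hm.isPrime).1 h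
    obtain ⟨h1, h2⟩ := Finset.mem_erase.1 hm'
    have h3 : m'.IsMaximal := by simpa using h2
    exact h1 (h3.eq_of_le hm.ne_top hle)
  obtain ⟨y, hy, hym⟩ := Set.not_subset.1 h
  have hy' : ∀ m' : Ideal R, m'.IsMaximal → m' ≠ m → y ∈ m' := fun m' h1 h2 ↦
    (Finset.inf_le (f := id) (Finset.mem_erase.2 ⟨h2, by simpa using h1⟩) : s.inf id ≤ m') hy
  refine ⟨y, fun h ↦ hym ?_, fun r hr ↦ ?_⟩
  · rw [Ring.jacobson_eq_sInf_isMaximal] at h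
    exact (Submodule.mem_sInf.1 h) m hm
  · rw [Ring.jacobson_eq_sInf_isMaximal]
    refine Submodule.mem_sInf.2 fun (m' : Ideal R) (hm' : m'.IsMaximal) ↦ ?_
    by_cases hmm : m' = m
    · subst hmm
      exact Ideal.mul_mem_right _ _ hr
    · exact Ideal.mul_mem_left _ _ (hy' m' hm' hmm)

/-- `J` is a cogenerator. -/
theorem exists_dualizing_ne_zero {X : Type u} [AddCommGroup X] [Module R X] {x : X} (hx : x ≠ 0) :
    ∃ φ : X →ₗ[R] dualizingModule R, φ x ≠ 0 := by
  let t : R →ₗ[R] X := LinearMap.toSpanSingleton R X x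
  have hne : LinearMap.ker t ≠ ⊤ := by
    intro h
    have : (1 : R) ∈ LinearMap.ker t := h ▸ Submodule.mem_top
    exact hx (by simpa [t] using this)
  obtain ⟨m, hm, hle⟩ := Ideal.exists_le_maximal (LinearMap.ker t) hne
  obtain ⟨y, hy, hmy⟩ := exists_notMem_jacobson m
  let q : R →ₗ[R] dualizingModule R :=
    toInjectiveEnvelope R _ ∘ₗ LinearMap.toSpanSingleton R (R ⧸ Ring.jacobson R)
      (Submodule.Quotient.mk y)
  have hq : LinearMap.ker t ≤ LinearMap.ker q := by
    intro r hr
    have h0 : r • (Submodule.Quotient.mk y : R ⧸ Ring.jacobson R) = 0 := by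
      rw [← Submodule.Quotient.mk_smul, Submodule.Quotient.mk_eq_zero]
      exact hmy r (hle hr)
    change toInjectiveEnvelope R _ (r • (Submodule.Quotient.mk y : R ⧸ Ring.jacobson R)) = 0
    rw [h0, map_zero]
  obtain ⟨ψ, hψ⟩ := exists_extend_dualizing ((LinearMap.ker t).liftQ t le_rfl)
    (LinearMap.ker_eq_bot.1 (Submodule.ker_liftQ_eq_bot _ _ _ le_rfl)) ((LinearMap.ker t).liftQ q hq)
  refine ⟨ψ, fun h0 ↦ ?_⟩
  have h1 := LinearMap.congr_fun hψ (Submodule.Quotient.mk 1)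
  have h2 : ψ ((1 : R) • x) =
      toInjectiveEnvelope R _ ((1 : R) • (Submodule.Quotient.mk y : R ⧸ Ring.jacobson R)) := h1
  have h3 : toInjectiveEnvelope R _ (Submodule.Quotient.mk y : R ⧸ Ring.jacobson R) = 0 := by
    rw [one_smul, one_smul, h0] at h2
    exact h2.symm
  have h4 := (isInjectiveEnvelope_toInjectiveEnvelope R (R ⧸ Ring.jacobson R)).injective
    (h3.trans (map_zero _).symm)
  exact hy ((Submodule.Quotient.mk_eq_zero _).1 h4)

theorem finite_dual (X : Type u) [AddCommGroup X] [Module R X] [Module.Finite R X] :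
    Module.Finite R (X →ₗ[R] dualizingModule R) := by
  have hX : IsFiniteLength R X :=
    isFiniteLength_iff_isNoetherian_isArtinian.2 ⟨inferInstance, inferInstance⟩
  have h := isFiniteLength_iff_isNoetherian_isArtinian.1 (Module.length_ne_top_iff.1
    (ne_top_of_le_ne_top (Module.length_ne_top_iff.2 hX) (length_dual_le hX)))
  have := h.1
  infer_instance

/-- Every functional on the dual of a finitely generated module is an evaluation. -/
theorem exists_eval_eq {X : Type u} [AddCommGroup X] [Module R X] [Module.Finite R X]
    (ψ : (X →ₗ[R] dualizingModule R) →ₗ[R] dualizingModule R) : ∃ x : X, ∀ φ, ψ φ = φ x := by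
  have hX : IsFiniteLength R X :=
    isFiniteLength_iff_isNoetherian_isArtinian.2 ⟨inferInstance, inferInstance⟩
  have := finite_dual (R := R) X
  have hDX : IsFiniteLength R (X →ₗ[R] dualizingModule R) :=
    isFiniteLength_iff_isNoetherian_isArtinian.2 ⟨inferInstance, inferInstance⟩
  have := finite_dual (R := R) (X →ₗ[R] dualizingModule R)
  let ev : X →ₗ[R] ((X →ₗ[R] dualizingModule R) →ₗ[R] dualizingModule R) := LinearMap.applyₗ
  have hinj : Function.Injective ev := by
    rw [injective_iff_map_eq_zero]
    intro x hx
    by_contra hne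
    obtain ⟨φ, hφ⟩ := exists_dualizing_ne_zero (R := R) hne
    exact hφ (LinearMap.congr_fun hx φ)
  have hlen := (length_dual_le hDX).trans (length_dual_le hX)
  have htop : LinearMap.range ev = ⊤ := by
    by_contra hne
    have h1 := Submodule.length_lt hne
    rw [← (LinearEquiv.ofInjective ev hinj).length_eq] at h1
    exact absurd hlen (not_le.2 h1)
  obtain ⟨x, hx⟩ := LinearMap.range_eq_top.1 htop ψ
  exact ⟨x, fun φ ↦ (LinearMap.congr_fun hx φ).symm⟩

end Matlis

/-! ### Duality between left and right modules over an Artin algebra -/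

section LeftDual

variable (R : Type u) [CommRing R] (A : Type u) [Ring A] [Algebra R A]

/-- The subgroup of `R`-linear maps `Y → J`, where `R` acts on the left `A`-module `Y` through
`R → A`. -/
def leftDualSubgroup (Y : Type u) [AddCommGroup Y] [Module A Y] :
    AddSubgroup (Y →+ dualizingModule R) where
  carrier := {φ | ∀ (r : R) (y : Y), φ (algebraMap R A r • y) = r • φ y}
  add_mem' {φ ψ} hφ hψ r x := by
    rw [AddMonoidHom.add_apply, AddMonoidHom.add_apply, hφ r x, hψ r x, smul_add]
  zero_mem' r x := (smul_zero r).symm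
  neg_mem' {φ} hφ r x := by
    rw [AddMonoidHom.neg_apply, AddMonoidHom.neg_apply, hφ r x, smul_neg]

/-- The duality `D'(Y) = Hom_R(Y, J)` on left `A`-modules, a quasi-inverse of `ArtinDual` on
finitely generated modules. -/
abbrev LeftDual (Y : Type u) [AddCommGroup Y] [Module A Y] : Type u := leftDualSubgroup R A Y

/-- `D'(Y)` is a right `A`-module via `(φ · a)(y) = φ(a y)`. -/
instance (Y : Type u) [AddCommGroup Y] [Module A Y] : Module Aᵐᵒᵖ (LeftDual R A Y) where
  smul a φ := ⟨φ.1.comp (DistribSMul.toAddMonoidHom Y a.unop), fun r x ↦ by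
    change φ.1 (a.unop • algebraMap R A r • x) = r • φ.1 (a.unop • x)
    rw [← φ.2, smul_smul, smul_smul, Algebra.commutes]⟩
  one_smul φ := Subtype.ext <| AddMonoidHom.ext fun x ↦ congrArg φ.1 (one_smul A x)
  mul_smul a b φ := Subtype.ext <| AddMonoidHom.ext fun x ↦
    congrArg φ.1 (mul_smul b.unop a.unop x)
  smul_zero _ := rfl
  smul_add _ _ _ := rfl
  add_smul a b φ := Subtype.ext <| AddMonoidHom.ext fun x ↦
    (congrArg φ.1 (add_smul a.unop b.unop x)).trans (map_add φ.1 _ _)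
  zero_smul φ := Subtype.ext <| AddMonoidHom.ext fun x ↦
    (congrArg φ.1 (zero_smul A x)).trans (map_zero φ.1)

theorem LeftDual.smul_apply (Y : Type u) [AddCommGroup Y] [Module A Y] (a : Aᵐᵒᵖ)
    (φ : LeftDual R A Y) (y : Y) : (a • φ).1 y = φ.1 (a.unop • y) := rfl

end LeftDual

/-! The dual of a right module over `A` is, as an abelian group, the dual of a left module over
`Aᵐᵒᵖ`, so that properties of the underlying groups need only be proved for `LeftDual`. -/

section Transfer

variable {R : Type u} [CommRing R] {A : Type u} [Ring A] [Algebra R A]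
variable {X Y : Type u} [AddCommGroup X] [Module A X] [AddCommGroup Y] [Module A Y]

theorem compHom_isScalarTower (R A X : Type u) [CommRing R] [Ring A] [Algebra R A]
    [AddCommGroup X] [Module A X] :
    letI : Module R X := Module.compHom X (algebraMap R A)
    IsScalarTower R A X := by
  let _ : Module R X := Module.compHom X (algebraMap R A)
  refine ⟨fun r a x ↦ ?_⟩
  rw [Algebra.smul_def, mul_smul]
  rfl

theorem compHom_finite (R A X : Type u) [CommRing R] [Ring A] [Algebra R A] [Module.Finite R A]
    [AddCommGroup X] [Module A X] [Module.Finite A X] :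
    letI : Module R X := Module.compHom X (algebraMap R A)
    Module.Finite R X := by
  let _ : Module R X := Module.compHom X (algebraMap R A)
  have := compHom_isScalarTower R A X
  exact Module.Finite.trans A X

theorem LeftDual.exists_extend (i : X →ₗ[A] Y) (hi : Function.Injective i)
    (φ : LeftDual R A X) : ∃ ψ : LeftDual R A Y, ∀ x, ψ.1 (i x) = φ.1 x := by
  let _ : Module R X := Module.compHom X (algebraMap R A)
  let _ : Module R Y := Module.compHom Y (algebraMap R A)
  let i' : X →ₗ[R] Y := { toFun := i, map_add' := map_add i, map_smul' := fun r x ↦ map_smul i _ x }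
  let φ' : X →ₗ[R] dualizingModule R := { toFun := φ.1, map_add' := map_add φ.1, map_smul' := φ.2 }
  obtain ⟨ψ, hψ⟩ := exists_extend_dualizing i' hi φ'
  exact ⟨⟨ψ.toAddMonoidHom, fun r y ↦ map_smul ψ r y⟩, fun x ↦ LinearMap.congr_fun hψ x⟩

variable [IsArtinianRing R]

theorem LeftDual.exists_ne_zero {x : X} (hx : x ≠ 0) : ∃ φ : LeftDual R A X, φ.1 x ≠ 0 := by
  let _ : Module R X := Module.compHom X (algebraMap R A)
  obtain ⟨ψ, hψ⟩ := exists_dualizing_ne_zero (R := R) hx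
  exact ⟨⟨ψ.toAddMonoidHom, fun r y ↦ map_smul ψ r y⟩, hψ⟩

theorem LeftDual.exists_eval [Module.Finite R A] [Module.Finite A X]
    (ψ : LeftDual R A X →+ dualizingModule R)
    (hψ : ∀ (r : R) (φ φ' : LeftDual R A X), (∀ x, φ'.1 x = φ.1 (algebraMap R A r • x)) →
      ψ φ' = r • ψ φ) :
    ∃ x : X, ∀ φ, ψ φ = φ.1 x := by
  let _ : Module R X := Module.compHom X (algebraMap R A)
  have := compHom_finite R A X
  let e (φ : X →ₗ[R] dualizingModule R) : LeftDual R A X :=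
    ⟨φ.toAddMonoidHom, fun r y ↦ map_smul φ r y⟩
  let ψ' : (X →ₗ[R] dualizingModule R) →ₗ[R] dualizingModule R :=
    { toFun := fun φ ↦ ψ (e φ)
      map_add' := fun φ φ' ↦ map_add ψ (e φ) (e φ')
      map_smul' := fun r φ ↦ hψ r (e φ) (e (r • φ)) fun x ↦ (map_smul φ r x).symm }
  obtain ⟨x, hx⟩ := exists_eval_eq ψ'
  refine ⟨x, fun φ ↦ ?_⟩
  exact hx { toFun := φ.1, map_add' := map_add φ.1, map_smul' := φ.2 }

theorem LeftDual.exists_generators [Module.Finite R A] [Module.Finite A X] :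
    ∃ (n : ℕ) (b : Fin n → LeftDual R A X), ∀ φ : LeftDual R A X, ∃ c : Fin n → R,
      ∀ x, φ.1 x = ∑ i, (b i).1 (algebraMap R A (c i) • x) := by
  let _ : Module R X := Module.compHom X (algebraMap R A)
  have := compHom_finite R A X
  have := finite_dual (R := R) X
  obtain ⟨n, s, hs⟩ := Module.Finite.exists_fin (R := R) (M := X →ₗ[R] dualizingModule R)
  refine ⟨n, fun i ↦ ⟨(s i).toAddMonoidHom, fun r y ↦ map_smul (s i) r y⟩, fun φ ↦ ?_⟩
  let φ' : X →ₗ[R] dualizingModule R := { toFun := φ.1, map_add' := map_add φ.1, map_smul' := φ.2 }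
  have h : φ' ∈ Submodule.span R (Set.range s) := hs ▸ Submodule.mem_top
  obtain ⟨c, hc⟩ := (Submodule.mem_span_range_iff_exists_fun R).1 h
  refine ⟨c, fun x ↦ (LinearMap.congr_fun hc x).symm.trans ?_⟩
  rw [LinearMap.sum_apply]
  exact Finset.sum_congr rfl fun i _ ↦ (map_smul (s i) (c i) x).symm

end Transfer

section Duality

theorem finite_opposite (R A : Type u) [CommRing R] [Ring A] [Algebra R A] [Module.Finite R A] :
    Module.Finite R Aᵐᵒᵖ := Module.Finite.equiv (MulOpposite.opLinearEquiv R)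

variable {R : Type u} [CommRing R] {A : Type u} [Ring A] [Algebra R A]
variable {X X' : Type u} [AddCommGroup X] [Module Aᵐᵒᵖ X] [AddCommGroup X'] [Module Aᵐᵒᵖ X']
variable {Y Y' : Type u} [AddCommGroup Y] [Module A Y] [AddCommGroup Y'] [Module A Y']

variable (R) in
/-- The action of `D` on maps of right modules. -/
def dualMap (f : X →ₗ[Aᵐᵒᵖ] X') : ArtinDual R A X' →ₗ[A] ArtinDual R A X where
  toFun φ := ⟨φ.1.comp f.toAddMonoidHom, fun r x ↦
    (congrArg φ.1 (map_smul f _ x)).trans (φ.2 r (f x))⟩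
  map_add' _ _ := rfl
  map_smul' a φ := Subtype.ext <| AddMonoidHom.ext fun x ↦
    congrArg φ.1 (map_smul f (op a) x).symm

@[simp] theorem dualMap_apply (f : X →ₗ[Aᵐᵒᵖ] X') (φ : ArtinDual R A X') (x : X) :
    (dualMap R f φ).1 x = φ.1 (f x) := rfl

variable (R) in
/-- The action of `D'` on maps of left modules. -/
def leftDualMap (f : Y →ₗ[A] Y') : LeftDual R A Y' →ₗ[Aᵐᵒᵖ] LeftDual R A Y where
  toFun φ := ⟨φ.1.comp f.toAddMonoidHom, fun r x ↦
    (congrArg φ.1 (map_smul f _ x)).trans (φ.2 r (f x))⟩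
  map_add' _ _ := rfl
  map_smul' a φ := Subtype.ext <| AddMonoidHom.ext fun x ↦
    congrArg φ.1 (map_smul f a.unop x).symm

@[simp] theorem leftDualMap_apply (f : Y →ₗ[A] Y') (φ : LeftDual R A Y') (y : Y) :
    (leftDualMap R f φ).1 y = φ.1 (f y) := rfl

theorem dual_ext {φ ψ : ArtinDual R A X} (h : ∀ x, φ.1 x = ψ.1 x) : φ = ψ :=
  Subtype.ext (AddMonoidHom.ext h)

theorem leftDual_ext {φ ψ : LeftDual R A Y} (h : ∀ x, φ.1 x = ψ.1 x) : φ = ψ :=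
  Subtype.ext (AddMonoidHom.ext h)

/-- One half of the adjunction `Hom(X, D' Y) = Hom(Y, D X)`. -/
def flipToDual (f : X →ₗ[Aᵐᵒᵖ] LeftDual R A Y) : Y →ₗ[A] ArtinDual R A X where
  toFun y := ⟨{ toFun := fun x ↦ (f x).1 y
                map_zero' := by rw [map_zero]; rfl
                map_add' := fun x x' ↦ by rw [map_add]; rfl }, fun r x ↦ by
      change (f (op (algebraMap R A r) • x)).1 y = r • (f x).1 y
      rw [map_smul, LeftDual.smul_apply]
      exact (f x).2 r y⟩
  map_add' y y' := dual_ext fun x ↦ map_add (f x).1 y y'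
  map_smul' a y := dual_ext fun x ↦ by
    change (f x).1 (a • y) = (f (op a • x)).1 y
    rw [map_smul f]
    rfl

/-- The other half of the adjunction `Hom(X, D' Y) = Hom(Y, D X)`. -/
def flipToLeftDual (f : Y →ₗ[A] ArtinDual R A X) : X →ₗ[Aᵐᵒᵖ] LeftDual R A Y where
  toFun x := ⟨{ toFun := fun y ↦ (f y).1 x
                map_zero' := by rw [map_zero]; rfl
                map_add' := fun x x' ↦ by rw [map_add]; rfl }, fun r y ↦ by
      change (f (algebraMap R A r • y)).1 x = r • (f y).1 x
      rw [map_smul, ArtinDual.smul_apply]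
      exact (f y).2 r x⟩
  map_add' x x' := leftDual_ext fun y ↦ map_add (f y).1 x x'
  map_smul' a x := leftDual_ext fun y ↦ by
    change (f y).1 (a • x) = (f (a.unop • y)).1 x
    rw [map_smul f]
    rfl

variable (R X) in
/-- The evaluation map `X → D' D X`. -/
def evalRight : X →ₗ[Aᵐᵒᵖ] LeftDual R A (ArtinDual R A X) := flipToLeftDual LinearMap.id

variable (R Y) in
/-- The evaluation map `Y → D D' Y`. -/
def evalLeft : Y →ₗ[A] ArtinDual R A (LeftDual R A Y) := flipToDual LinearMap.id

@[simp] theorem evalRight_apply (x : X) (φ : ArtinDual R A X) :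
    (evalRight R X x).1 φ = φ.1 x := rfl

@[simp] theorem evalLeft_apply (y : Y) (φ : LeftDual R A Y) :
    (evalLeft R Y y).1 φ = φ.1 y := rfl

theorem dualMap_surjective (i : X →ₗ[Aᵐᵒᵖ] X') (hi : Function.Injective i) :
    Function.Surjective (dualMap R i) := fun φ ↦ by
  obtain ⟨ψ, hψ⟩ := LeftDual.exists_extend (R := R) (A := Aᵐᵒᵖ) i hi φ
  exact ⟨ψ, dual_ext hψ⟩

theorem dualMap_injective (p : X →ₗ[Aᵐᵒᵖ] X') (hp : Function.Surjective p) :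
    Function.Injective (dualMap R p) := fun φ ψ h ↦ dual_ext fun x ↦ by
  obtain ⟨x, rfl⟩ := hp x
  exact DFunLike.congr_fun (congrArg Subtype.val h) x

theorem leftDualMap_injective (p : Y →ₗ[A] Y') (hp : Function.Surjective p) :
    Function.Injective (leftDualMap R p) := fun φ ψ h ↦ leftDual_ext fun x ↦ by
  obtain ⟨x, rfl⟩ := hp x
  exact DFunLike.congr_fun (congrArg Subtype.val h) x

/-- `D'` turns projective modules into injective modules, by the adjunction with `D`. -/
theorem injective_leftDual (P : Type u) [AddCommGroup P] [Module A P] [Module.Projective A P] :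
    Module.Injective Aᵐᵒᵖ (LeftDual R A P) := by
  refine ⟨fun X Y _ _ _ _ i hi g ↦ ?_⟩
  obtain ⟨h, hh⟩ := Module.projective_lifting_property (dualMap R i) (flipToDual g)
    (dualMap_surjective i hi)
  refine ⟨flipToLeftDual h, fun x ↦ leftDual_ext fun p ↦ ?_⟩
  exact DFunLike.congr_fun (congrArg Subtype.val (LinearMap.congr_fun hh p)) x

variable [IsArtinianRing R]

theorem dual_exists_ne_zero {x : X} (hx : x ≠ 0) : ∃ φ : ArtinDual R A X, φ.1 x ≠ 0 :=
  LeftDual.exists_ne_zero (R := R) (A := Aᵐᵒᵖ) hx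

theorem leftDualMap_inj {f g : Y →ₗ[A] Y'} : leftDualMap R f = leftDualMap R g ↔ f = g := by
  refine ⟨fun h ↦ ?_, fun h ↦ h ▸ rfl⟩
  ext y
  by_contra hne
  obtain ⟨φ, hφ⟩ := LeftDual.exists_ne_zero (R := R) (A := A) (sub_ne_zero.2 hne)
  refine hφ ?_
  rw [map_sub, sub_eq_zero]
  exact DFunLike.congr_fun (congrArg Subtype.val (LinearMap.congr_fun h φ)) y

variable [Module.Finite R A]

theorem evalRight_bijective [Module.Finite Aᵐᵒᵖ X] : Function.Bijective (evalRight (A := A) R X) := by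
  have := finite_opposite R A
  constructor
  · rw [injective_iff_map_eq_zero]
    intro x hx
    by_contra hne
    obtain ⟨φ, hφ⟩ := dual_exists_ne_zero (R := R) (A := A) hne
    exact hφ (DFunLike.congr_fun (congrArg Subtype.val hx) φ)
  · intro ψ
    obtain ⟨x, hx⟩ := LeftDual.exists_eval (R := R) (A := Aᵐᵒᵖ) (X := X) ψ.1 fun r φ φ' h ↦
      (congrArg ψ.1 (dual_ext (R := R) (A := A) h)).trans (ψ.2 r φ)
    exact ⟨x, leftDual_ext fun φ ↦ (hx φ).symm⟩

theorem evalLeft_bijective [Module.Finite A Y] : Function.Bijective (evalLeft (A := A) R Y) := by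
  constructor
  · rw [injective_iff_map_eq_zero]
    intro x hx
    by_contra hne
    obtain ⟨φ, hφ⟩ := LeftDual.exists_ne_zero (R := R) (A := A) hne
    exact hφ (DFunLike.congr_fun (congrArg Subtype.val hx) φ)
  · intro ψ
    obtain ⟨x, hx⟩ := LeftDual.exists_eval (R := R) (A := A) (X := Y) ψ.1 fun r φ φ' h ↦ by
      rw [← ψ.2 r φ]
      exact congrArg ψ.1 (leftDual_ext h)
    exact ⟨x, dual_ext fun φ ↦ (hx φ).symm⟩

theorem finite_dual_right [Module.Finite Aᵐᵒᵖ X] : Module.Finite A (ArtinDual R A X) := by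
  have := finite_opposite R A
  obtain ⟨n, b, hb⟩ := LeftDual.exists_generators (R := R) (A := Aᵐᵒᵖ) (X := X)
  let b' : Fin n → ArtinDual R A X := b
  refine Module.Finite.of_surjective (Fintype.linearCombination A b') fun φ ↦ ?_
  obtain ⟨c, hc⟩ := hb φ
  refine ⟨fun i ↦ algebraMap R A (c i), dual_ext fun x ↦ ?_⟩
  rw [Fintype.linearCombination_apply, AddSubgroup.val_finsetSum, AddMonoidHom.finsetSum_apply]
  exact (hc x).symm

theorem finite_leftDual [Module.Finite A Y] : Module.Finite Aᵐᵒᵖ (LeftDual R A Y) := by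
  obtain ⟨n, b, hb⟩ := LeftDual.exists_generators (R := R) (A := A) (X := Y)
  refine Module.Finite.of_surjective (Fintype.linearCombination Aᵐᵒᵖ b) fun φ ↦ ?_
  obtain ⟨c, hc⟩ := hb φ
  refine ⟨fun i ↦ op (algebraMap R A (c i)), leftDual_ext fun x ↦ ?_⟩
  rw [Fintype.linearCombination_apply, AddSubgroup.val_finsetSum, AddMonoidHom.finsetSum_apply]
  exact (hc x).symm

/-- `D'` is full on finitely generated modules. -/
theorem exists_leftDualMap_eq [Module.Finite A Y] (F : LeftDual R A Y →ₗ[Aᵐᵒᵖ] LeftDual R A Y') :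
    ∃ f : Y' →ₗ[A] Y, leftDualMap R f = F := by
  let e := LinearEquiv.ofBijective (evalLeft (A := A) R Y) evalLeft_bijective
  refine ⟨e.symm.toLinearMap ∘ₗ dualMap R F ∘ₗ evalLeft R Y', ?_⟩
  ext1 ξ
  refine leftDual_ext fun y ↦ ?_
  have h := e.apply_symm_apply (dualMap R F (evalLeft R Y' y))
  exact DFunLike.congr_fun (congrArg Subtype.val h) ξ

end Duality

/-! ### The functor `T ↦ Tf` and the modules it determines -/

section CornerPart

variable {A : Type u} [Ring A] {f : A}
variable {T T' Y : Type u} [AddCommGroup T] [Module Aᵐᵒᵖ T] [AddCommGroup T'] [Module Aᵐᵒᵖ T']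
  [AddCommGroup Y] [Module Aᵐᵒᵖ Y]

variable (f) in
/-- The element `f` of `Af`. -/
def idealGen : LeftIdealOf f := ⟨f, Ideal.mem_span_singleton_self f⟩

theorem mem_leftIdeal_of_mul_eq {x : A} (h : x * f = x) : x ∈ Ideal.span {f} :=
  Ideal.mem_span_singleton'.2 ⟨x, h⟩

/-- The element `f y = f y f` of `fAf` attached to `y` in `Af`. -/
def cornerOf (hf : IsIdempotentElem f) (y : LeftIdealOf f) : hf.Corner :=
  ⟨f * y, f * y, by
    change f * (f * (y : A)) * f = _
    rw [← mul_assoc, hf.eq, mul_assoc, mul_idem_eq hf]⟩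

theorem corner_smul_coe (hf : IsIdempotentElem f) (c : (hf.Corner)ᵐᵒᵖ) (x : LeftIdealOf f) :
    ((c • x : LeftIdealOf f) : A) = (x : A) * c.unop.1 := rfl

/-- Products in `Af` are products with elements of the corner ring. -/
theorem coe_smul_eq (hf : IsIdempotentElem f) (x y : LeftIdealOf f) :
    (x : A) • y = op (cornerOf hf y) • x := by
  apply Subtype.ext
  change (x : A) * (y : A) = (x : A) * (f * (y : A))
  rw [← mul_assoc, mul_idem_eq hf]

theorem coe_smul_idealGen (hf : IsIdempotentElem f) (x : LeftIdealOf f) :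
    (x : A) • idealGen f = x := Subtype.ext (mul_idem_eq hf x)

variable (f T) in
/-- The elements `t` of a right module `T` with `t f = t`. -/
def cornerPart : AddSubgroup T where
  carrier := {t | op f • t = t}
  add_mem' {a b} ha hb := by
    change op f • (a + b) = a + b
    rw [smul_add, show op f • a = a from ha, show op f • b = b from hb]
  zero_mem' := smul_zero _
  neg_mem' {a} ha := by
    change op f • (-a) = -a
    rw [smul_neg, show op f • a = a from ha]

variable (f T) in
/-- The right `fAf`-module `Tf`. -/
abbrev CornerPart : Type u := cornerPart f T

theorem op_smul_mem_cornerPart {a : A} (h : a * f = a) (t : T) : op a • t ∈ cornerPart f T := by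
  change op f • op a • t = op a • t
  rw [smul_smul, ← op_mul, h]

theorem corner_mul_idem (hf : IsIdempotentElem f) (c : hf.Corner) : c.1 * f = c.1 :=
  ((Subsemigroup.mem_corner_iff hf).1 c.2).2

instance (hf : IsIdempotentElem f) : Module (hf.Corner)ᵐᵒᵖ (CornerPart f T) where
  smul c t := ⟨op c.unop.1 • t.1, op_smul_mem_cornerPart (corner_mul_idem hf c.unop) _⟩
  one_smul t := Subtype.ext t.2
  mul_smul c d t := Subtype.ext (mul_smul (op c.unop.1) (op d.unop.1) t.1)
  smul_zero _ := Subtype.ext (smul_zero _)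
  smul_add _ _ _ := Subtype.ext (smul_add _ _ _)
  add_smul c d t := Subtype.ext (add_smul (op c.unop.1) (op d.unop.1) t.1)
  zero_smul t := Subtype.ext (zero_smul Aᵐᵒᵖ t.1)

theorem cornerPart_smul_coe (hf : IsIdempotentElem f) (c : (hf.Corner)ᵐᵒᵖ) (t : CornerPart f T) :
    ((c • t : CornerPart f T) : T) = op c.unop.1 • (t : T) := rfl

/-- The map `Tf → T'f` induced by a map `T → T'` of right `A`-modules. -/
def cornerMap (hf : IsIdempotentElem f) (F : T →ₗ[Aᵐᵒᵖ] T') :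
    CornerPart f T →ₗ[(hf.Corner)ᵐᵒᵖ] CornerPart f T' where
  toFun t := ⟨F t, by
    change op f • F t = F t
    rw [← map_smul, show op f • (t : T) = t from t.2]⟩
  map_add' x y := Subtype.ext (map_add F _ _)
  map_smul' c t := Subtype.ext (map_smul F (op c.unop.1) t.1)

@[simp] theorem cornerMap_coe (hf : IsIdempotentElem f) (F : T →ₗ[Aᵐᵒᵖ] T') (t : CornerPart f T) :
    (cornerMap hf F t : T') = F t := rfl

/-- The map `Af → Tf`, `x ↦ t x`, attached to an element `t` of `T`. -/
def cornerAct (hf : IsIdempotentElem f) (t : T) :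
    LeftIdealOf f →ₗ[(hf.Corner)ᵐᵒᵖ] CornerPart f T where
  toFun x := ⟨op (x : A) • t, op_smul_mem_cornerPart (mul_idem_eq hf x) t⟩
  map_add' x y := Subtype.ext (add_smul (op (x : A)) (op (y : A)) t)
  map_smul' c x := Subtype.ext (mul_smul (op c.unop.1) (op (x : A)) t)

@[simp] theorem cornerAct_coe (hf : IsIdempotentElem f) (t : T) (x : LeftIdealOf f) :
    (cornerAct hf t x : T) = op (x : A) • t := rfl

variable (T) in
/-- A right `A`-module `T` is corner-closed if the natural map `T → Hom_{fAf}(Af, Tf)` is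
bijective. -/
def IsCornerClosed (hf : IsIdempotentElem f) : Prop :=
  Function.Bijective (cornerAct hf : T → LeftIdealOf f →ₗ[(hf.Corner)ᵐᵒᵖ] CornerPart f T)

theorem IsCornerClosed.ext {hf : IsIdempotentElem f} (hT : IsCornerClosed T hf) {s t : T}
    (h : ∀ x : LeftIdealOf f, op (x : A) • s = op (x : A) • t) : s = t :=
  hT.1 (LinearMap.ext fun x ↦ Subtype.ext (h x))

theorem IsCornerClosed.exists_eq {hf : IsIdempotentElem f} (hT : IsCornerClosed T hf)
    (θ : LeftIdealOf f →ₗ[(hf.Corner)ᵐᵒᵖ] CornerPart f T) :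
    ∃ t : T, ∀ x, (θ x : T) = op (x : A) • t := by
  obtain ⟨t, ht⟩ := hT.2 θ
  exact ⟨t, fun x ↦ ht ▸ rfl⟩

/-- If the identity of `T'` is a sum of two maps that factor through corner-closed modules, then
`T'` is corner-closed. -/
theorem IsCornerClosed.of_retract {hf : IsIdempotentElem f} (hT : IsCornerClosed T hf)
    (hY : IsCornerClosed Y hf) (i : T' →ₗ[Aᵐᵒᵖ] T) (p : T →ₗ[Aᵐᵒᵖ] T') (j : T' →ₗ[Aᵐᵒᵖ] Y)
    (q : Y →ₗ[Aᵐᵒᵖ] T') (h : ∀ t, p (i t) + q (j t) = t) : IsCornerClosed T' hf := by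
  constructor
  · intro s t hst
    have hst' : ∀ x : LeftIdealOf f, op (x : A) • s = op (x : A) • t := fun x ↦
      congrArg Subtype.val (LinearMap.congr_fun hst x)
    have h1 : i s = i t := hT.ext fun x ↦ by rw [← map_smul, ← map_smul, hst']
    have h2 : j s = j t := hY.ext fun x ↦ by rw [← map_smul, ← map_smul, hst']
    rw [← h s, ← h t, h1, h2]
  · intro θ
    obtain ⟨t, ht⟩ := hT.exists_eq (cornerMap hf i ∘ₗ θ)
    obtain ⟨y, hy⟩ := hY.exists_eq (cornerMap hf j ∘ₗ θ)
    refine ⟨p t + q y, LinearMap.ext fun x ↦ Subtype.ext ?_⟩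
    rw [cornerAct_coe, smul_add, ← map_smul, ← map_smul, ← ht, ← hy]
    exact h _

theorem IsCornerClosed.of_equiv {hf : IsIdempotentElem f} (hT : IsCornerClosed T hf)
    (e : T ≃ₗ[Aᵐᵒᵖ] T') : IsCornerClosed T' hf :=
  hT.of_retract hT e.symm.toLinearMap e.toLinearMap 0 0 fun t ↦ by simp

/-- The functor `T ↦ Tf` is full on maps to corner-closed modules. -/
theorem IsCornerClosed.exists_cornerMap_eq {hf : IsIdempotentElem f} (hT' : IsCornerClosed T' hf)
    (ψ : CornerPart f T →ₗ[(hf.Corner)ᵐᵒᵖ] CornerPart f T') :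
    ∃ F : T →ₗ[Aᵐᵒᵖ] T', cornerMap hf F = ψ := by
  choose F hF using fun t : T ↦ hT'.exists_eq (ψ ∘ₗ cornerAct hf t)
  refine ⟨{ toFun := F, map_add' := fun s t ↦ ?_, map_smul' := fun a t ↦ ?_ }, ?_⟩
  · refine hT'.ext fun x ↦ ?_
    have : cornerAct hf (s + t) x = cornerAct hf s x + cornerAct hf t x :=
      Subtype.ext (smul_add _ _ _)
    rw [smul_add, ← hF, ← hF, ← hF, LinearMap.comp_apply, this, map_add]
    rfl
  · refine hT'.ext fun x ↦ ?_
    have h1 : cornerAct hf (a • t) x = cornerAct hf t (a.unop • x) :=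
      Subtype.ext (mul_smul (op (x : A)) a t).symm
    rw [RingHom.id_apply, ← hF, smul_smul, LinearMap.comp_apply, h1]
    exact hF t (a.unop • x)
  · refine LinearMap.ext fun t ↦ Subtype.ext ?_
    have h1 : cornerAct hf (t : T) (idealGen f) = t := Subtype.ext t.2
    have h2 := hF t (idealGen f)
    rw [LinearMap.comp_apply, h1] at h2
    -- `F t` is fixed by `f`, since `t` is and `F` is determined by its values on `Af`.
    have h3 : op f • F t = F t := by
      refine hT'.ext fun x ↦ ?_
      have h4 : cornerAct hf (t : T) (f • x) = cornerAct hf (t : T) x := by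
        refine Subtype.ext ?_
        rw [cornerAct_coe, cornerAct_coe]
        conv_rhs => rw [← show op f • (t : T) = t from t.2, smul_smul]
        rfl
      have h5 := hF t (f • x)
      rw [LinearMap.comp_apply, h4, ← LinearMap.comp_apply, hF t x] at h5
      rw [h5, smul_smul]
      rfl
    change F t = _
    rw [h2]
    exact h3.symm

/-- The functor `T ↦ Tf` is faithful on maps to corner-closed modules. -/
theorem IsCornerClosed.cornerMap_injective {hf : IsIdempotentElem f} (hT' : IsCornerClosed T' hf)
    {F G : T →ₗ[Aᵐᵒᵖ] T'} (h : cornerMap hf F = cornerMap hf G) : F = G :=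
  LinearMap.ext fun t ↦ hT'.ext fun x ↦ by
    rw [← map_smul, ← map_smul]
    exact congrArg Subtype.val (LinearMap.congr_fun h (cornerAct hf t x))

/-- A map of corner-closed modules is bijective if it is so on the corner parts. -/
theorem IsCornerClosed.bijective_of_cornerMap {hf : IsIdempotentElem f} (hT : IsCornerClosed T hf)
    (hT' : IsCornerClosed T' hf) (F : T →ₗ[Aᵐᵒᵖ] T')
    (h : Function.Bijective (cornerMap hf F)) : Function.Bijective F := by
  let e := LinearEquiv.ofBijective (cornerMap hf F) h
  obtain ⟨G, hG⟩ := hT.exists_cornerMap_eq e.symm.toLinearMap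
  have hG' : ∀ t, cornerMap hf G t = e.symm t := fun t ↦ LinearMap.congr_fun hG t
  have h1 : G ∘ₗ F = LinearMap.id := hT.cornerMap_injective <| LinearMap.ext fun t ↦ by
    change cornerMap hf G (cornerMap hf F t) = t
    rw [hG']
    exact e.symm_apply_apply t
  have h2 : F ∘ₗ G = LinearMap.id := hT'.cornerMap_injective <| LinearMap.ext fun t ↦ by
    change cornerMap hf F (cornerMap hf G t) = t
    rw [hG']
    exact e.apply_symm_apply t
  exact ⟨Function.LeftInverse.injective (LinearMap.congr_fun h1),
    Function.RightInverse.surjective (LinearMap.congr_fun h2)⟩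

/-- If `A` is corner-closed, so are all duals of left modules. -/
theorem isCornerClosed_star {hf : IsIdempotentElem f} (hA : IsCornerClosed A hf)
    (W : Type u) [AddCommGroup W] [Module A W] : IsCornerClosed (Star A W) hf := by
  constructor
  · intro φ ψ h
    refine LinearMap.ext fun w ↦ hA.ext fun x ↦ ?_
    exact LinearMap.congr_fun (congrArg Subtype.val (LinearMap.congr_fun h x)) w
  · intro θ
    have hθ : ∀ x w, op f • (θ x : Star A W) w = (θ x : Star A W) w := fun x w ↦
      LinearMap.congr_fun (θ x).2 w
    let θ' (w : W) : LeftIdealOf f →ₗ[(hf.Corner)ᵐᵒᵖ] CornerPart f A :=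
      { toFun := fun x ↦ ⟨(θ x : Star A W) w, hθ x w⟩
        map_add' := fun x y ↦
          Subtype.ext (LinearMap.congr_fun (congrArg Subtype.val (map_add θ x y)) w)
        map_smul' := fun c x ↦
          Subtype.ext (LinearMap.congr_fun (congrArg Subtype.val (map_smul θ c x)) w) }
    choose a ha using fun w ↦ hA.exists_eq (θ' w)
    refine ⟨{ toFun := a, map_add' := fun v w ↦ ?_, map_smul' := fun b w ↦ ?_ }, ?_⟩
    · refine hA.ext fun x ↦ ?_
      rw [smul_add, ← ha, ← ha, ← ha]
      exact map_add (θ x : Star A W) v w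
    · refine hA.ext fun x ↦ ?_
      rw [RingHom.id_apply, smul_comm, ← ha, ← ha]
      exact map_smul (θ x : Star A W) b w
    · refine LinearMap.ext fun x ↦ Subtype.ext (LinearMap.ext fun w ↦ ?_)
      exact (ha w x).symm

/-- The map `A → Y`, `a ↦ y a`, of right modules. -/
def rightSpan (y : Y) : A →ₗ[Aᵐᵒᵖ] Y where
  toFun a := op a • y
  map_add' a b := by rw [MulOpposite.op_add, add_smul]
  map_smul' a b := (mul_smul a (op b) y)

@[simp] theorem rightSpan_apply (y : Y) (a : A) : rightSpan y a = op a • y := rfl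

/-- `Af` is the corner part of `A`. -/
def idealEquivCornerPart (hf : IsIdempotentElem f) :
    LeftIdealOf f ≃ₗ[(hf.Corner)ᵐᵒᵖ] CornerPart f A where
  toFun x := ⟨x, mul_idem_eq hf x⟩
  invFun x := ⟨x, mem_leftIdeal_of_mul_eq x.2⟩
  map_add' _ _ := rfl
  map_smul' _ _ := rfl
  left_inv _ := rfl
  right_inv _ := rfl

/-- If `F : T → T'` becomes a map factoring through `add(Af)` on corner parts, then `F` factors
through every epimorphism `Y → T'`. -/
theorem exists_lift_of_cornerMap_eq {hf : IsIdempotentElem f} (hA : IsCornerClosed A hf)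
    (hT' : IsCornerClosed T' hf) (F : T →ₗ[Aᵐᵒᵖ] T') {n : ℕ}
    (g : CornerPart f T →ₗ[(hf.Corner)ᵐᵒᵖ] (Fin n → LeftIdealOf f))
    (v : (Fin n → LeftIdealOf f) →ₗ[(hf.Corner)ᵐᵒᵖ] CornerPart f T')
    (h : cornerMap hf F = v ∘ₗ g) (c : Y →ₗ[Aᵐᵒᵖ] T') (hc : Function.Surjective c) :
    ∃ b : T →ₗ[Aᵐᵒᵖ] Y, c ∘ₗ b = F := by
  choose U hU using fun j : Fin n ↦ hA.exists_cornerMap_eq (T := T)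
    ((idealEquivCornerPart hf).toLinearMap ∘ₗ LinearMap.proj j ∘ₗ g)
  choose t' ht' using fun j : Fin n ↦ hT'.exists_eq (v ∘ₗ LinearMap.single (hf.Corner)ᵐᵒᵖ (fun _ ↦ LeftIdealOf f) j)
  choose y hy using fun j ↦ hc (t' j)
  refine ⟨∑ j, rightSpan (y j) ∘ₗ U j, hT'.cornerMap_injective ?_⟩
  rw [h]
  refine LinearMap.ext fun t ↦ Subtype.ext ?_
  have h1 : ∀ j, U j (t : T) = (g t j : A) := fun j ↦
    congrArg Subtype.val (LinearMap.congr_fun (hU j) t)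
  rw [cornerMap_coe, LinearMap.comp_apply, LinearMap.comp_apply, LinearMap.sum_apply, map_sum]
  have h2 : v (g t) = ∑ j, v (Pi.single j (g t j)) := by
    rw [← map_sum, Finset.univ_sum_single]
  rw [h2, AddSubgroup.val_finsetSum]
  refine Finset.sum_congr rfl fun j _ ↦ ?_
  rw [LinearMap.comp_apply, rightSpan_apply, map_smul, hy, h1]
  exact (ht' j (g t j)).symm

end CornerPart

/-! ### The right module `Hom_{fAf}(Af, N)` -/

section HomIdeal

variable {A : Type u} [Ring A] {f : A} (hf : IsIdempotentElem f)
variable (N : Type u) [AddCommGroup N] [Module (hf.Corner)ᵐᵒᵖ N]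

/-- `Hom_{fAf}(Af, N)`. -/
def HomIdeal : Type u := LeftIdealOf f →ₗ[(hf.Corner)ᵐᵒᵖ] N

instance : AddCommGroup (HomIdeal hf N) :=
  inferInstanceAs (AddCommGroup (LeftIdealOf f →ₗ[(hf.Corner)ᵐᵒᵖ] N))

/-- Left multiplication on `Af`, a map of right `fAf`-modules. -/
def idealMulLeft (a : A) : LeftIdealOf f →ₗ[(hf.Corner)ᵐᵒᵖ] LeftIdealOf f where
  toFun x := a • x
  map_add' := smul_add a
  map_smul' c x := Subtype.ext (mul_assoc a (x : A) c.unop.1).symm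

/-- `Hom_{fAf}(Af, N)` is a right `A`-module via `(φ · a)(x) = φ(a x)`. -/
instance : Module Aᵐᵒᵖ (HomIdeal hf N) where
  smul a φ := LinearMap.comp φ (idealMulLeft hf a.unop)
  one_smul φ := LinearMap.ext fun x ↦ congrArg φ.toFun (one_smul A x)
  mul_smul a b φ := LinearMap.ext fun x ↦ congrArg φ.toFun (mul_smul b.unop a.unop x)
  smul_zero _ := rfl
  smul_add _ _ _ := rfl
  add_smul a b φ := LinearMap.ext fun x ↦
    (congrArg φ.toFun (add_smul a.unop b.unop x)).trans (LinearMap.map_add φ _ _)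
  zero_smul φ := LinearMap.ext fun x ↦
    (congrArg φ.toFun (zero_smul A x)).trans (LinearMap.map_zero φ)

variable {hf N}

/-- The underlying linear map of an element of `Hom_{fAf}(Af, N)`. -/
def HomIdeal.toHom (φ : HomIdeal hf N) : LeftIdealOf f →ₗ[(hf.Corner)ᵐᵒᵖ] N := φ

theorem HomIdeal.toHom_smul (a : Aᵐᵒᵖ) (φ : HomIdeal hf N) (x : LeftIdealOf f) :
    (a • φ).toHom x = φ.toHom (a.unop • x) := rfl

theorem HomIdeal.ext {φ ψ : HomIdeal hf N} (h : ∀ x, φ.toHom x = ψ.toHom x) : φ = ψ :=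
  LinearMap.ext h

variable (hf N)

theorem isCornerClosed_homIdeal : IsCornerClosed (HomIdeal hf N) hf := by
  constructor
  · intro φ ψ h
    refine HomIdeal.ext fun x ↦ ?_
    have h1 : (op (x : A) • φ).toHom (idealGen f) = (op (x : A) • ψ).toHom (idealGen f) :=
      congrArg (fun s : CornerPart f (HomIdeal hf N) ↦ s.1.toHom (idealGen f))
        (LinearMap.congr_fun h x)
    rwa [HomIdeal.toHom_smul, HomIdeal.toHom_smul, unop_op, coe_smul_idealGen hf] at h1
  · intro θ
    have hθ : ∀ x y, (θ x).1.toHom (f • y) = (θ x).1.toHom y := fun x y ↦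
      congrArg (fun φ : HomIdeal hf N ↦ φ.toHom y) (θ x).2
    let φ : LeftIdealOf f →ₗ[(hf.Corner)ᵐᵒᵖ] N :=
      { toFun := fun x ↦ (θ x).1.toHom (idealGen f)
        map_add' := fun x y ↦ by rw [map_add]; rfl
        map_smul' := fun c x ↦ by
          rw [map_smul, cornerPart_smul_coe, HomIdeal.toHom_smul, RingHom.id_apply, ← map_smul]
          refine congrArg _ (Subtype.ext ?_)
          exact (corner_mul_idem hf c.unop).trans
            ((Subsemigroup.mem_corner_iff hf).1 c.unop.2).1.symm }
    refine ⟨φ, LinearMap.ext fun x ↦ Subtype.ext (HomIdeal.ext fun y ↦ ?_)⟩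
    change (θ ((x : A) • y)).1.toHom (idealGen f) = (θ x).1.toHom y
    rw [coe_smul_eq hf, map_smul, cornerPart_smul_coe, HomIdeal.toHom_smul, ← hθ x y]
    refine congrArg _ (Subtype.ext ?_)
    exact corner_mul_idem hf (cornerOf hf y)

/-- `N` is recovered as the corner part of `Hom_{fAf}(Af, N)`. -/
def homIdealCornerEquiv : CornerPart f (HomIdeal hf N) ≃ₗ[(hf.Corner)ᵐᵒᵖ] N where
  toFun φ := φ.1.toHom (idealGen f)
  map_add' _ _ := rfl
  map_smul' c φ := by
    rw [cornerPart_smul_coe, HomIdeal.toHom_smul, RingHom.id_apply, ← map_smul]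
    refine congrArg _ (Subtype.ext ?_)
    exact (corner_mul_idem hf c.unop).trans ((Subsemigroup.mem_corner_iff hf).1 c.unop.2).1.symm
  invFun n := ⟨LinearMap.mk ⟨fun x ↦ op (cornerOf hf x) • n, fun x y ↦ by
        have : cornerOf hf (x + y) = cornerOf hf x + cornerOf hf y :=
          Subtype.ext (mul_add f (x : A) (y : A))
        rw [this, MulOpposite.op_add, add_smul]⟩ fun c x ↦ by
        have : op (cornerOf hf (c • x)) = c * op (cornerOf hf x) :=
          unop_injective (Subtype.ext (mul_assoc f (x : A) c.unop.1).symm)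
        rw [RingHom.id_apply, smul_smul, ← this], HomIdeal.ext fun x ↦ by
      have : cornerOf hf (f • x) = cornerOf hf x := Subtype.ext (by
        change f * (f * (x : A)) = f * (x : A)
        rw [← mul_assoc, hf.eq])
      change op (cornerOf hf (f • x)) • n = op (cornerOf hf x) • n
      rw [this]⟩
  left_inv φ := Subtype.ext <| HomIdeal.ext fun x ↦ by
    change op (cornerOf hf x) • φ.1.toHom (idealGen f) = φ.1.toHom x
    rw [← map_smul]
    have h : φ.1.toHom (f • x) = φ.1.toHom x :=
      congrArg (fun φ : HomIdeal hf N ↦ φ.toHom x) φ.2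
    rw [← h]
    refine congrArg _ (Subtype.ext ?_)
    change f * (f * (x : A)) = f * (x : A)
    rw [← mul_assoc, hf.eq]
  right_inv n := by
    have : cornerOf hf (idealGen f) = 1 := Subtype.ext hf.eq
    change op (cornerOf hf (idealGen f)) • n = n
    rw [this, MulOpposite.op_one, one_smul]

end HomIdeal

/-! ### Finite generation over the corner ring -/

section CornerFinite

variable (R : Type u) [CommRing R] {A : Type u} [Ring A] [Algebra R A] {f : A}
  (hf : IsIdempotentElem f)

/-- The additive map `A → (fAf)ᵐᵒᵖ`, `a ↦ f a f`. -/
def toCorner : A →+ (hf.Corner)ᵐᵒᵖ where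
  toFun a := op ⟨f * a * f, a, rfl⟩
  map_zero' := unop_injective (Subtype.ext (by
    change f * 0 * f = 0
    rw [mul_zero, zero_mul]))
  map_add' a b := unop_injective (Subtype.ext (by
    change f * (a + b) * f = f * a * f + f * b * f
    rw [mul_add, add_mul]))

theorem toCorner_coe (a : A) : (toCorner hf a).unop.1 = f * a * f := rfl

theorem toCorner_coe_algebraMap (r : R) :
    (toCorner hf (algebraMap R A r)).unop.1 = algebraMap R A r * f := by
  rw [toCorner_coe, ← Algebra.commutes, mul_assoc, hf.eq]

/-- The structure map of `(fAf)ᵐᵒᵖ` as an `R`-algebra. -/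
def cornerAlgebraMap : R →+* (hf.Corner)ᵐᵒᵖ :=
  { (toCorner hf).comp (algebraMap R A).toAddMonoidHom with
    map_one' := unop_injective (Subtype.ext (by
      change f * algebraMap R A 1 * f = f
      rw [map_one, mul_one, hf.eq]))
    map_mul' := fun r s ↦ unop_injective (Subtype.ext (by
      change (toCorner hf (algebraMap R A (r * s))).unop.1 =
        (toCorner hf (algebraMap R A s)).unop.1 * (toCorner hf (algebraMap R A r)).unop.1
      rw [toCorner_coe_algebraMap, toCorner_coe_algebraMap, toCorner_coe_algebraMap, mul_comm r,
        map_mul, mul_assoc (algebraMap R A s) f, ← mul_assoc f, ← Algebra.commutes r f,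
        mul_assoc _ f f, hf.eq, mul_assoc])) }

theorem cornerAlgebraMap_coe (r : R) :
    (cornerAlgebraMap R hf r).unop.1 = algebraMap R A r * f := toCorner_coe_algebraMap R hf r

/-- `(fAf)ᵐᵒᵖ` is an `R`-algebra. -/
abbrev cornerAlgebra : Algebra R (hf.Corner)ᵐᵒᵖ :=
  (cornerAlgebraMap R hf).toAlgebra' fun r c ↦ unop_injective (Subtype.ext (by
    change c.unop.1 * (cornerAlgebraMap R hf r).unop.1 = (cornerAlgebraMap R hf r).unop.1 * c.unop.1
    have h := (Subsemigroup.mem_corner_iff hf).1 c.unop.2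
    rw [cornerAlgebraMap_coe, mul_assoc, h.1, ← mul_assoc, ← Algebra.commutes, mul_assoc, h.2]))

theorem corner_finite [Module.Finite R A] :
    letI := cornerAlgebra R hf
    Module.Finite R (hf.Corner)ᵐᵒᵖ := by
  let _ := cornerAlgebra R hf
  let p : A →ₗ[R] (hf.Corner)ᵐᵒᵖ := { toCorner hf with
    map_smul' := fun r a ↦ unop_injective (Subtype.ext ?_) }
  · refine Module.Finite.of_surjective p fun c ↦ ?_
    obtain ⟨a, ha⟩ := c.unop.2
    exact ⟨a, unop_injective (Subtype.ext ha)⟩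
  · change f * (r • a) * f = (f * a * f) * (cornerAlgebraMap R hf r).unop.1
    rw [cornerAlgebraMap_coe, Algebra.commutes r f, ← mul_assoc, mul_assoc _ f f, hf.eq,
      ← Algebra.commutes, mul_smul_comm, smul_mul_assoc, Algebra.smul_def]

end CornerFinite

theorem finite_cornerPart (R : Type u) [CommRing R] {A : Type u} [Ring A] [Algebra R A]
    [Module.Finite R A] {f : A} (hf : IsIdempotentElem f) (T : Type u) [AddCommGroup T] [Module Aᵐᵒᵖ T] [Module.Finite Aᵐᵒᵖ T] :
    Module.Finite (hf.Corner)ᵐᵒᵖ (CornerPart f T) := by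
  let _ := cornerAlgebra R hf
  let _ : Module R T := Module.compHom T (algebraMap R Aᵐᵒᵖ)
  let _ : Module R (CornerPart f T) :=
    Module.compHom (CornerPart f T) (algebraMap R (hf.Corner)ᵐᵒᵖ)
  have := finite_opposite R A
  have := compHom_finite R Aᵐᵒᵖ T
  have := compHom_isScalarTower R (hf.Corner)ᵐᵒᵖ (CornerPart f T)
  have : Module.Finite R (CornerPart f T) := by
    let p : T →ₗ[R] CornerPart f T :=
      { toFun := fun t ↦ ⟨op f • t, op_smul_mem_cornerPart hf.eq t⟩
        map_add' := fun s t ↦ Subtype.ext (smul_add _ _ _)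
        map_smul' := fun r t ↦ Subtype.ext ?_ }
    · exact Module.Finite.of_surjective p fun t ↦ ⟨t, Subtype.ext t.2⟩
    change op f • op (algebraMap R A r) • t = op (cornerAlgebraMap R hf r).unop.1 • op f • t
    rw [cornerAlgebraMap_coe, smul_smul, smul_smul, ← MulOpposite.op_mul, ← MulOpposite.op_mul,
      ← mul_assoc, ← Algebra.commutes r f, mul_assoc, hf.eq]
  exact Module.Finite.of_restrictScalars_finite R (hf.Corner)ᵐᵒᵖ (CornerPart f T)

theorem finite_homIdeal (R : Type u) [CommRing R] {A : Type u} [Ring A] [Algebra R A]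
    [Module.Finite R A] {f : A} (hf : IsIdempotentElem f) [IsArtinianRing R]
    (N : Type u) [AddCommGroup N]
    [Module (hf.Corner)ᵐᵒᵖ N] [Module.Finite (hf.Corner)ᵐᵒᵖ N] :
    Module.Finite Aᵐᵒᵖ (HomIdeal hf N) := by
  let _ := cornerAlgebra R hf
  let _ : Module R N := Module.compHom N (algebraMap R (hf.Corner)ᵐᵒᵖ)
  let _ : Module R (HomIdeal hf N) := Module.compHom (HomIdeal hf N) (algebraMap R Aᵐᵒᵖ)
  let _ : Module R (LeftIdealOf f) := Module.compHom (LeftIdealOf f) (algebraMap R A)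
  have := corner_finite R hf
  have := compHom_finite R (hf.Corner)ᵐᵒᵖ N
  have := compHom_isScalarTower R Aᵐᵒᵖ (HomIdeal hf N)
  have := compHom_finite R A (LeftIdealOf f)
  obtain ⟨n, s, hs⟩ := Module.Finite.exists_fin (R := R) (M := LeftIdealOf f)
  have hlin : ∀ (φ : HomIdeal hf N) (r : R) (x : LeftIdealOf f),
      φ.toHom (algebraMap R A r • x) = r • φ.toHom x := fun φ r x ↦ by
    have h : algebraMap R A r • x = cornerAlgebraMap R hf r • x := by
      refine Subtype.ext ?_
      rw [corner_smul_coe, cornerAlgebraMap_coe, Algebra.commutes, ← mul_assoc, mul_idem_eq hf,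
        ← Algebra.commutes]
      rfl
    rw [h, map_smul]
    rfl
  let ev : HomIdeal hf N →ₗ[R] (Fin n → N) :=
    { toFun := fun φ i ↦ φ.toHom (s i)
      map_add' := fun _ _ ↦ rfl
      map_smul' := fun r φ ↦ funext fun i ↦ hlin φ r (s i) }
  have hev : Function.Injective ev := fun φ ψ h ↦ HomIdeal.ext fun x ↦ by
    obtain ⟨c, rfl⟩ := (Submodule.mem_span_range_iff_exists_fun R).1
      (hs ▸ Submodule.mem_top : x ∈ Submodule.span R (Set.range s))
    rw [map_sum, map_sum]
    refine Finset.sum_congr rfl fun i _ ↦ ?_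
    exact (hlin φ _ _).trans ((congrArg (c i • ·) (congrFun h i)).trans (hlin ψ _ _).symm)
  have : Module.Finite R (HomIdeal hf N) := Module.Finite.of_injective ev hev
  exact Module.Finite.of_restrictScalars_finite R Aᵐᵒᵖ (HomIdeal hf N)

/-! ### The double centralizer property of `Af` -/

/-- If `Af` is projective and faithful and the second term of the minimal injective coresolution
of the right module `A` is projective, then `A → End_{fAf}(Af)` is bijective.

The functor `T ↦ Hom_{fAf}(Af, Tf)` is left exact, and `D'(Af)` is corner-closed. Therefore it is
enough to embed `A` into a power `Q` of `D'(Af)` in such a way that maps `Q → D'(Af)` which vanish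
on `A` separate the points of `Q / A`. Such maps are found by splitting off an injective envelope
of `A` from `Q`. -/
theorem isCornerClosed_self (R : Type u) [CommRing R] [IsArtinianRing R] {A : Type u} [Ring A]
    [Algebra R A] {f : A} (hf : IsIdempotentElem f) [Module.Projective A (LeftIdealOf f)] [FaithfulSMul A (LeftIdealOf f)]
    (hE : Module.Projective Aᵐᵒᵖ (minimalInjectiveTerm Aᵐᵒᵖ A 1)) : IsCornerClosed A hf := by
  constructor
  · intro a b h
    refine FaithfulSMul.eq_of_smul_eq_smul (α := LeftIdealOf f) fun x ↦ Subtype.ext ?_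
    exact congrArg (fun t : CornerPart f A ↦ (t : A)) (LinearMap.congr_fun h x)
  intro θ
  let φ : LeftIdealOf f →ₗ[(hf.Corner)ᵐᵒᵖ] LeftIdealOf f :=
    (idealEquivCornerPart hf).symm.toLinearMap ∘ₗ θ
  have hφ : ∀ x y : LeftIdealOf f, φ ((x : A) • y) = (φ x : A) • y := fun x y ↦ by
    rw [coe_smul_eq hf, coe_smul_eq hf, map_smul]
  let D := LeftDual R A (LeftIdealOf f)
  have hD : Module.Injective Aᵐᵒᵖ D := injective_leftDual _
  have hfaith : ∀ b : Aᵐᵒᵖ, (∀ ξ : D, b • ξ = 0) → b = 0 := fun b hb ↦ by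
    refine unop_injective (FaithfulSMul.eq_of_smul_eq_smul (α := LeftIdealOf f) fun x ↦ ?_)
    rw [unop_zero, zero_smul]
    by_contra hne
    obtain ⟨ξ, hξ⟩ := LeftDual.exists_ne_zero (R := R) (A := A) hne
    exact hξ (DFunLike.congr_fun (congrArg Subtype.val (hb ξ)) x)
  have hsep : ∀ ζ : D, (∀ x : LeftIdealOf f, op (x : A) • ζ = 0) → ζ = 0 := fun ζ h ↦
    leftDual_ext fun x ↦ by
      have h1 := DFunLike.congr_fun (congrArg Subtype.val (h x)) (idealGen f)
      rwa [LeftDual.smul_apply, unop_op, coe_smul_idealGen hf] at h1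
  let i₀ := toInjectiveEnvelope Aᵐᵒᵖ A
  have hi₀ := isInjectiveEnvelope_toInjectiveEnvelope Aᵐᵒᵖ A
  let E₁ := injectiveEnvelope Aᵐᵒᵖ (injectiveEnvelope Aᵐᵒᵖ A ⧸ LinearMap.range i₀)
  let i₁ := toInjectiveEnvelope Aᵐᵒᵖ (injectiveEnvelope Aᵐᵒᵖ A ⧸ LinearMap.range i₀)
  have hi₁ := isInjectiveEnvelope_toInjectiveEnvelope Aᵐᵒᵖ
    (injectiveEnvelope Aᵐᵒᵖ A ⧸ LinearMap.range i₀)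
  have hE₁ : Module.Projective Aᵐᵒᵖ E₁ := hE
  -- Maps to `D` separate the points of the projective module `E₁`.
  have hE₁sep : ∀ z : E₁, z ≠ 0 → ∃ χ : E₁ →ₗ[Aᵐᵒᵖ] D, χ z ≠ 0 := fun z hz ↦ by
    obtain ⟨s, hs⟩ := Module.projective_def.1 hE₁
    have h1 : s z ≠ 0 := fun h ↦ hz (by rw [← hs z, h, map_zero])
    obtain ⟨e, he⟩ := Finsupp.ne_iff.1 h1
    by_contra! hcon
    refine he (hfaith _ fun ξ ↦ ?_)
    exact hcon (LinearMap.toSpanSingleton Aᵐᵒᵖ D ξ ∘ₗ Finsupp.lapply e ∘ₗ s)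
  choose j hj using fun ξ : D ↦ hD.out i₀ hi₀.injective (rightSpan ξ)
  let J : injectiveEnvelope Aᵐᵒᵖ A →ₗ[Aᵐᵒᵖ] (D → D) := LinearMap.pi j
  have hJinj : Function.Injective J := by
    rw [← LinearMap.ker_eq_bot]
    refine hi₀.essential _ ?_
    rw [Submodule.eq_bot_iff]
    rintro _ ⟨hx, a, rfl⟩
    have h1 : op a = 0 := hfaith _ fun ξ ↦ (hj ξ a).symm.trans (congrFun hx ξ)
    rw [op_eq_zero_iff] at h1
    rw [h1, map_zero]
  obtain ⟨r, hr⟩ := hi₀.injective_module.out J hJinj LinearMap.id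
  have hr' : ∀ e, r (J e) = e := hr
  let ζ (ξ : D) : D := ⟨ξ.1.comp φ.toAddMonoidHom, fun s x ↦ by
    change ξ.1 (φ (algebraMap R A s • x)) = s • ξ.1 (φ x)
    -- Scalars from `R` act on `Af` through the corner ring.
    have h1 : ∀ y : LeftIdealOf f, algebraMap R A s • y =
        (y : A) • (algebraMap R A s • idealGen f) := fun y ↦ by
      refine Subtype.ext ?_
      change algebraMap R A s * (y : A) = (y : A) * (algebraMap R A s * f)
      rw [Algebra.commutes s f, ← mul_assoc, mul_idem_eq hf, Algebra.commutes]
    rw [h1, hφ, ← h1]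
    exact ξ.2 s (φ x)⟩
  let q : D → D := ζ
  have hq : ∀ x : LeftIdealOf f, op (x : A) • q = J (i₀ (φ x)) := fun x ↦ funext fun ξ ↦ by
    refine Eq.trans (leftDual_ext fun y ↦ ?_) (hj ξ (φ x)).symm
    change ξ.1 (φ ((x : A) • y)) = ξ.1 ((φ x : A) • y)
    rw [hφ]
  have hrq : r q ∈ LinearMap.range i₀ := by
    rw [← Submodule.Quotient.mk_eq_zero]
    by_contra hne
    obtain ⟨χ, hχ⟩ := hE₁sep (i₁ (Submodule.Quotient.mk (r q)))
      fun h ↦ hne (hi₁.injective (h.trans (map_zero _).symm))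
    refine hχ (hsep _ fun x ↦ ?_)
    have h1 : (Submodule.Quotient.mk (i₀ (φ x)) :
        injectiveEnvelope Aᵐᵒᵖ A ⧸ LinearMap.range i₀) = 0 :=
      (Submodule.Quotient.mk_eq_zero _).2 ⟨_, rfl⟩
    rw [← map_smul, ← map_smul, ← Submodule.Quotient.mk_smul, ← map_smul, hq, hr', h1, map_zero,
      map_zero]
  obtain ⟨a, ha⟩ := hrq
  have hqa : q = J (i₀ a) := by
    rw [← sub_eq_zero]
    refine funext fun ξ ↦ hsep _ fun x ↦ ?_
    have h1 : op (x : A) • (q - J (i₀ a)) = 0 := by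
      rw [smul_sub, ha, ← map_smul, ← map_smul, hq, hr', sub_self]
    exact congrFun h1 ξ
  refine ⟨a, LinearMap.ext fun x ↦ Subtype.ext ?_⟩
  have h2 : J (i₀ (φ x)) = J (i₀ (op (x : A) • a)) := by
    rw [← hq, hqa, ← map_smul, ← map_smul]
  exact (hi₀.injective (hJinj h2)).symm

/-! ### The `A`-dual of finitely generated projective modules -/

section StarProjective

variable {A : Type u} [Ring A] {P Q Y : Type u} [AddCommGroup P] [Module A P]
  [AddCommGroup Q] [Module A Q] [AddCommGroup Y] [Module A Y]

@[simp] theorem starMap_apply (g : Q →ₗ[A] P) (φ : Star A P) : starMap g φ = φ ∘ₗ g := rfl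

theorem star_smul_apply (a : A) (φ : Star A P) (x : P) : (op a • φ) x = φ x * a := rfl

theorem starMap_comp (g : Q →ₗ[A] P) (h : Y →ₗ[A] Q) :
    starMap (g ∘ₗ h) = starMap h ∘ₗ starMap g := rfl

variable (A P) in
theorem exists_dualBasis [Module.Finite A P] [Module.Projective A P] :
    ∃ (n : ℕ) (p : Fin n → P) (q : Fin n → Star A P), ∀ x, ∑ i, q i x • p i = x := by
  obtain ⟨n, F, G, -, -, h⟩ := Module.Finite.exists_comp_eq_id_of_projective A P
  refine ⟨n, fun i ↦ F (Pi.single i 1), fun i ↦ LinearMap.proj i ∘ₗ G, fun x ↦ ?_⟩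
  conv_rhs => rw [← LinearMap.id_apply (R := A) x, ← h, LinearMap.comp_apply,
    ← Finset.univ_sum_single (G x), map_sum]
  refine Finset.sum_congr rfl fun i _ ↦ ?_
  rw [← map_smul, ← Pi.single_smul, smul_eq_mul, mul_one]
  rfl

theorem eq_sum_dualBasis {n : ℕ} {p : Fin n → P} {q : Fin n → Star A P}
    (h : ∀ x, ∑ i, q i x • p i = x) (φ : Star A P) : ∑ i, op (φ (p i)) • q i = φ := by
  ext x
  conv_rhs => rw [← h x, map_sum]
  rw [LinearMap.sum_apply]
  exact Finset.sum_congr rfl fun i _ ↦ (map_smul φ (q i x) (p i)).symm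

variable (A P) in
theorem exists_star_split [Module.Finite A P] [Module.Projective A P] :
    ∃ (n : ℕ) (i : Star A P →ₗ[Aᵐᵒᵖ] (Fin n → Aᵐᵒᵖ)) (r : (Fin n → Aᵐᵒᵖ) →ₗ[Aᵐᵒᵖ] Star A P),
      r ∘ₗ i = LinearMap.id := by
  obtain ⟨n, p, q, h⟩ := exists_dualBasis A P
  let i : Star A P →ₗ[Aᵐᵒᵖ] (Fin n → Aᵐᵒᵖ) :=
    { toFun := fun φ j ↦ op (φ (p j))
      map_add' := fun _ _ ↦ rfl
      map_smul' := fun _ _ ↦ rfl }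
  refine ⟨n, i, Fintype.linearCombination Aᵐᵒᵖ q, LinearMap.ext fun φ ↦ ?_⟩
  exact eq_sum_dualBasis h φ

variable (A P) in
theorem projective_star [Module.Finite A P] [Module.Projective A P] :
    Module.Projective Aᵐᵒᵖ (Star A P) := by
  obtain ⟨n, i, r, h⟩ := exists_star_split A P
  exact Module.Projective.of_split i r h

variable (A P) in
theorem finite_star [Module.Finite A P] [Module.Projective A P] :
    Module.Finite Aᵐᵒᵖ (Star A P) := by
  obtain ⟨n, i, r, h⟩ := exists_star_split A P
  exact Module.Finite.of_surjective r fun φ ↦ ⟨i φ, LinearMap.congr_fun h φ⟩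

/-- Every map `P* → Y*` is the dual of a map `Y → P`, for `P` finitely generated projective. -/
theorem exists_starMap_eq [Module.Finite A P] [Module.Projective A P]
    (F : Star A P →ₗ[Aᵐᵒᵖ] Star A Y) : ∃ g : Y →ₗ[A] P, starMap g = F := by
  obtain ⟨n, p, q, h⟩ := exists_dualBasis A P
  refine ⟨∑ i, (F (q i)).smulRight (p i), LinearMap.ext fun φ ↦ ?_⟩
  conv_rhs => rw [← eq_sum_dualBasis h φ, map_sum]
  ext y
  rw [starMap_apply, LinearMap.comp_apply, LinearMap.sum_apply, LinearMap.sum_apply, map_sum]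
  refine Finset.sum_congr rfl fun i _ ↦ ?_
  rw [LinearMap.smulRight_apply, map_smul, map_smul]
  rfl

theorem starMap_injective [Module.Finite A P] [Module.Projective A P] {g h : Y →ₗ[A] P}
    (hgh : starMap g = starMap h) : g = h := by
  obtain ⟨n, p, q, hpq⟩ := exists_dualBasis A P
  ext y
  rw [← hpq (g y), ← hpq (h y)]
  refine Finset.sum_congr rfl fun i _ ↦ ?_
  rw [show q i (g y) = q i (h y) from LinearMap.congr_fun (LinearMap.congr_fun hgh (q i)) y]

/-- For a finitely generated projective left module `P`, the right `fAf`-module `P* f` lies in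
`add(Af)`. -/
theorem isDirectSummandOf_cornerPart_star {f : A} (hf : IsIdempotentElem f) (P : Type u)
    [AddCommGroup P] [Module A P] [Module.Finite A P] [Module.Projective A P] :
    ∃ n : ℕ, IsDirectSummandOf (hf.Corner)ᵐᵒᵖ (CornerPart f (Star A P))
      (Fin n → LeftIdealOf f) := by
  obtain ⟨n, p, q, h⟩ := exists_dualBasis A P
  have hmem : ∀ (φ : CornerPart f (Star A P)) (x : P), φ.1 x ∈ Ideal.span {f} := fun φ x ↦
    mem_leftIdeal_of_mul_eq (LinearMap.congr_fun φ.2 x)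
  let i : CornerPart f (Star A P) →ₗ[(hf.Corner)ᵐᵒᵖ] (Fin n → LeftIdealOf f) :=
    { toFun := fun φ j ↦ ⟨φ.1 (p j), hmem φ _⟩
      map_add' := fun _ _ ↦ rfl
      map_smul' := fun _ _ ↦ rfl }
  refine ⟨n, i,
    { toFun := fun m ↦ ⟨∑ j, op (m j : A) • q j, (cornerPart f (Star A P)).sum_mem fun j _ ↦
        op_smul_mem_cornerPart (mul_idem_eq hf (m j)) (q j)⟩
      map_add' := fun m m' ↦ Subtype.ext ?_
      map_smul' := fun c m ↦ Subtype.ext ?_ }, LinearMap.ext fun φ ↦ Subtype.ext ?_⟩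
  · rw [AddSubgroup.coe_add, ← Finset.sum_add_distrib]
    change ∑ j, op ((m + m') j : A) • q j = _
    exact Finset.sum_congr rfl fun j _ ↦ add_smul (op (m j : A)) (op (m' j : A)) (q j)
  · rw [RingHom.id_apply, cornerPart_smul_coe, Finset.smul_sum]
    change ∑ j, op ((c • m) j : A) • q j = _
    exact Finset.sum_congr rfl fun j _ ↦ mul_smul (op c.unop.1) (op (m j : A)) (q j)
  · exact eq_sum_dualBasis h φ.1

end StarProjective

/-! ### Maps of presentations up to homotopy -/

section Presentation

/-- The map of cokernels induced by `d` factors through the projection onto its target if and only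
if `d γ = γ' s γ` for some `s`: a factorization corresponds to a map `d - γ' s` that vanishes on the
image of `γ`. -/
theorem exists_factor_iff {Λ : Type u} [Ring Λ] {Q₁ Q₀ Q₁' Q₀' : Type u}
    [AddCommGroup Q₁] [Module Λ Q₁] [AddCommGroup Q₀] [Module Λ Q₀] [Module.Projective Λ Q₀]
    [AddCommGroup Q₁'] [Module Λ Q₁'] [AddCommGroup Q₀'] [Module Λ Q₀']
    (γ : Q₁ →ₗ[Λ] Q₀) (γ' : Q₁' →ₗ[Λ] Q₀') (d : Q₀ →ₗ[Λ] Q₀')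
    (h : LinearMap.range γ ≤ (LinearMap.range γ').comap d) :
    (∃ e : (Q₀ ⧸ LinearMap.range γ) →ₗ[Λ] Q₀',
      (LinearMap.range γ').mkQ ∘ₗ e = Submodule.mapQ _ _ d h) ↔
    ∃ s : Q₀ →ₗ[Λ] Q₁', d ∘ₗ γ = γ' ∘ₗ s ∘ₗ γ := by
  constructor
  · rintro ⟨e, he⟩
    have hmem : ∀ x, (d - e ∘ₗ (LinearMap.range γ).mkQ) x ∈ LinearMap.range γ' := fun x ↦ by
      rw [← Submodule.Quotient.mk_eq_zero, LinearMap.sub_apply, Submodule.Quotient.mk_sub,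
        sub_eq_zero]
      exact (LinearMap.congr_fun he ((LinearMap.range γ).mkQ x)).symm
    obtain ⟨s, hs⟩ := Module.projective_lifting_property γ'.rangeRestrict
      ((d - e ∘ₗ (LinearMap.range γ).mkQ).codRestrict _ hmem) γ'.surjective_rangeRestrict
    refine ⟨s, LinearMap.ext fun x ↦ ?_⟩
    have h1 : γ' (s (γ x)) = d (γ x) - e ((LinearMap.range γ).mkQ (γ x)) :=
      congrArg Subtype.val (LinearMap.congr_fun hs (γ x))
    have h2 : (LinearMap.range γ).mkQ (γ x) = 0 := (Submodule.Quotient.mk_eq_zero _).2 ⟨x, rfl⟩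
    rw [h2, map_zero, sub_zero] at h1
    exact h1.symm
  · rintro ⟨s, hs⟩
    refine ⟨(LinearMap.range γ).liftQ (d - γ' ∘ₗ s) ?_, ?_⟩
    · rintro _ ⟨x, rfl⟩
      rw [LinearMap.mem_ker, LinearMap.sub_apply, sub_eq_zero]
      exact LinearMap.congr_fun hs x
    · refine Submodule.linearMap_qext _ (LinearMap.ext fun x ↦ ?_)
      change Submodule.Quotient.mk (d x - γ' (s x)) = Submodule.Quotient.mk (d x)
      rw [Submodule.Quotient.mk_sub, sub_eq_self, Submodule.Quotient.mk_eq_zero]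
      exact ⟨_, rfl⟩

variable {A : Type u} [Ring A]
variable {P₁ P₀ P₁' P₀' : Type u} [AddCommGroup P₁] [Module A P₁] [AddCommGroup P₀] [Module A P₀]
  [AddCommGroup P₁'] [Module A P₁'] [AddCommGroup P₀'] [Module A P₀']

/-- The cokernel of `g* : P₀* → P₁*`. -/
abbrev CokerStar (g : P₁ →ₗ[A] P₀) : Type u := Star A P₁ ⧸ LinearMap.range (starMap g)

/-- The cokernel of `g : P₁ → P₀`. -/
abbrev Coker (g : P₁ →ₗ[A] P₀) : Type u := P₀ ⧸ LinearMap.range g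

variable {g : P₁ →ₗ[A] P₀} {g' : P₁' →ₗ[A] P₀'}

/-- The map of cokernels induced by a commutative square. -/
def cokerMap (a₁ : P₁' →ₗ[A] P₁) (a₀ : P₀' →ₗ[A] P₀) (h : g ∘ₗ a₁ = a₀ ∘ₗ g') :
    Coker g' →ₗ[A] Coker g :=
  Submodule.mapQ _ _ a₀ (by
    rintro _ ⟨x, rfl⟩
    exact ⟨a₁ x, LinearMap.congr_fun h x⟩)

/-- The map of cokernels of the dual maps induced by a commutative square. -/
def cokerStarMap (a₁ : P₁' →ₗ[A] P₁) (a₀ : P₀' →ₗ[A] P₀) (h : g ∘ₗ a₁ = a₀ ∘ₗ g') :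
    CokerStar g →ₗ[Aᵐᵒᵖ] CokerStar g' :=
  Submodule.mapQ _ _ (starMap a₁) (by
    rintro _ ⟨φ, rfl⟩
    exact ⟨starMap a₀ φ, by rw [← LinearMap.comp_apply, ← LinearMap.comp_apply, ← starMap_comp,
      ← starMap_comp, h]⟩)

@[simp] theorem cokerMap_mk (a₁ : P₁' →ₗ[A] P₁) (a₀ : P₀' →ₗ[A] P₀) (h : g ∘ₗ a₁ = a₀ ∘ₗ g')
    (x : P₀') : cokerMap a₁ a₀ h (Submodule.Quotient.mk x) = Submodule.Quotient.mk (a₀ x) := rfl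

@[simp] theorem cokerStarMap_mk (a₁ : P₁' →ₗ[A] P₁) (a₀ : P₀' →ₗ[A] P₀) (h : g ∘ₗ a₁ = a₀ ∘ₗ g')
    (φ : Star A P₁) :
    cokerStarMap a₁ a₀ h (Submodule.Quotient.mk φ) = Submodule.Quotient.mk (φ ∘ₗ a₁) := rfl

theorem cokerMap_id (g : P₁ →ₗ[A] P₀) :
    cokerMap (g := g) (g' := g) LinearMap.id LinearMap.id rfl = LinearMap.id :=
  Submodule.linearMap_qext _ rfl

theorem cokerStarMap_id (g : P₁ →ₗ[A] P₀) :
    cokerStarMap (g := g) (g' := g) LinearMap.id LinearMap.id rfl = LinearMap.id :=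
  Submodule.linearMap_qext _ rfl

theorem comp_square {P₁'' P₀'' : Type u} [AddCommGroup P₁''] [Module A P₁''] [AddCommGroup P₀'']
    [Module A P₀''] {g'' : P₁'' →ₗ[A] P₀''} {a₁ : P₁' →ₗ[A] P₁} {a₀ : P₀' →ₗ[A] P₀}
    {b₁ : P₁'' →ₗ[A] P₁'} {b₀ : P₀'' →ₗ[A] P₀'} (h : g ∘ₗ a₁ = a₀ ∘ₗ g')
    (h' : g' ∘ₗ b₁ = b₀ ∘ₗ g'') : g ∘ₗ (a₁ ∘ₗ b₁) = (a₀ ∘ₗ b₀) ∘ₗ g'' := by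
  rw [← LinearMap.comp_assoc, h, LinearMap.comp_assoc, h', LinearMap.comp_assoc]

theorem cokerMap_comp {P₁'' P₀'' : Type u} [AddCommGroup P₁''] [Module A P₁'']
    [AddCommGroup P₀''] [Module A P₀''] {g'' : P₁'' →ₗ[A] P₀''} {a₁ : P₁' →ₗ[A] P₁}
    {a₀ : P₀' →ₗ[A] P₀} {b₁ : P₁'' →ₗ[A] P₁'} {b₀ : P₀'' →ₗ[A] P₀'} (h : g ∘ₗ a₁ = a₀ ∘ₗ g')
    (h' : g' ∘ₗ b₁ = b₀ ∘ₗ g'') : cokerMap (a₁ ∘ₗ b₁) (a₀ ∘ₗ b₀) (comp_square h h') =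
      cokerMap a₁ a₀ h ∘ₗ cokerMap b₁ b₀ h' :=
  Submodule.linearMap_qext _ rfl

theorem cokerStarMap_comp {P₁'' P₀'' : Type u} [AddCommGroup P₁''] [Module A P₁'']
    [AddCommGroup P₀''] [Module A P₀''] {g'' : P₁'' →ₗ[A] P₀''} {a₁ : P₁' →ₗ[A] P₁}
    {a₀ : P₀' →ₗ[A] P₀} {b₁ : P₁'' →ₗ[A] P₁'} {b₀ : P₀'' →ₗ[A] P₀'} (h : g ∘ₗ a₁ = a₀ ∘ₗ g')
    (h' : g' ∘ₗ b₁ = b₀ ∘ₗ g'') : cokerStarMap (a₁ ∘ₗ b₁) (a₀ ∘ₗ b₀) (comp_square h h') =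
      cokerStarMap b₁ b₀ h' ∘ₗ cokerStarMap a₁ a₀ h :=
  Submodule.linearMap_qext _ rfl

/-- A square of projective modules induces a map from `coker g'` to `coker g` that factors through
`P₀` if and only if the map it induces from `coker g*` to `coker g'*` factors through `P₁'*`: both
conditions say that `a₀ g' = g s g'` for some `s`. -/
theorem cokerMap_factor_iff [Module.Projective A P₀'] [Module.Finite A P₁] [Module.Projective A P₁]
    [Module.Finite A P₀] [Module.Projective A P₀] (a₁ : P₁' →ₗ[A] P₁) (a₀ : P₀' →ₗ[A] P₀)
    (h : g ∘ₗ a₁ = a₀ ∘ₗ g') :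
    (∃ e : Coker g' →ₗ[A] P₀, (LinearMap.range g).mkQ ∘ₗ e = cokerMap a₁ a₀ h) ↔
    ∃ b : CokerStar g →ₗ[Aᵐᵒᵖ] Star A P₁',
      (LinearMap.range (starMap g')).mkQ ∘ₗ b = cokerStarMap a₁ a₀ h := by
  have := projective_star A P₁
  refine (exists_factor_iff g' g a₀ _).trans (Iff.trans ?_
    (exists_factor_iff (starMap g) (starMap g') (starMap a₁) _).symm)
  rw [← h]
  constructor
  · rintro ⟨s, hs⟩
    refine ⟨starMap s, ?_⟩
    rw [← starMap_comp, hs]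
    rfl
  · rintro ⟨σ, hσ⟩
    obtain ⟨s, rfl⟩ := exists_starMap_eq σ
    exact ⟨s, starMap_injective hσ⟩

/-- Maps of modules lift to maps of projective presentations. -/
theorem exists_lift_presentation [Module.Projective A P₁'] [Module.Projective A P₀']
    {Z Z' : Type u} [AddCommGroup Z] [Module A Z] [AddCommGroup Z'] [Module A Z']
    (p : P₀ →ₗ[A] Z) (hp : Function.Surjective p) (hpg : LinearMap.ker p = LinearMap.range g)
    (p' : P₀' →ₗ[A] Z') (hpg' : LinearMap.range g' ≤ LinearMap.ker p') (v : Z' →ₗ[A] Z) :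
    ∃ (a₁ : P₁' →ₗ[A] P₁) (a₀ : P₀' →ₗ[A] P₀), g ∘ₗ a₁ = a₀ ∘ₗ g' ∧ p ∘ₗ a₀ = v ∘ₗ p' := by
  obtain ⟨a₀, ha₀⟩ := Module.projective_lifting_property p (v ∘ₗ p') hp
  have hmem : ∀ x, (a₀ ∘ₗ g') x ∈ LinearMap.range g := fun x ↦ by
    rw [← hpg, LinearMap.mem_ker, ← LinearMap.comp_apply, ← LinearMap.comp_assoc, ha₀]
    change v (p' (g' x)) = 0
    rw [show p' (g' x) = 0 from hpg' ⟨x, rfl⟩, map_zero]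
  obtain ⟨a₁, ha₁⟩ := Module.projective_lifting_property g.rangeRestrict
    ((a₀ ∘ₗ g').codRestrict _ hmem) g.surjective_rangeRestrict
  exact ⟨a₁, a₀, LinearMap.ext fun x ↦ congrArg Subtype.val (LinearMap.congr_fun ha₁ x), ha₀⟩

/-- Whether the cokernel of `g*` is corner-closed depends only on the module that `g` presents. -/
theorem IsCornerClosed.of_presentation {f : A} {hf : IsIdempotentElem f}
    (hA : IsCornerClosed A hf)
    [Module.Finite A P₁] [Module.Projective A P₁] [Module.Finite A P₀] [Module.Projective A P₀]
    [Module.Finite A P₁'] [Module.Projective A P₁'] [Module.Finite A P₀'] [Module.Projective A P₀']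
    {Z : Type u} [AddCommGroup Z] [Module A Z]
    (p : P₀ →ₗ[A] Z) (hp : Function.Surjective p) (hpg : LinearMap.ker p = LinearMap.range g)
    (p' : P₀' →ₗ[A] Z) (hp' : Function.Surjective p') (hpg' : LinearMap.ker p' = LinearMap.range g')
    (h : IsCornerClosed (CokerStar g) hf) : IsCornerClosed (CokerStar g') hf := by
  obtain ⟨a₁, a₀, ha, hpa⟩ := exists_lift_presentation p hp hpg p' hpg'.ge LinearMap.id
  obtain ⟨c₁, c₀, hc, hpc⟩ := exists_lift_presentation p' hp' hpg' p hpg.ge LinearMap.id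
  have hd : g' ∘ₗ (LinearMap.id - c₁ ∘ₗ a₁) = (LinearMap.id - c₀ ∘ₗ a₀) ∘ₗ g' := by
    rw [LinearMap.comp_sub, LinearMap.sub_comp, LinearMap.comp_id, LinearMap.id_comp,
      ← LinearMap.comp_assoc, hc, LinearMap.comp_assoc, ha, LinearMap.comp_assoc]
  -- The endomorphism `1 - c a` of the presentation of `Z` induces zero on `Z`.
  have hzero : cokerMap _ _ hd = 0 := by
    refine Submodule.linearMap_qext _ (LinearMap.ext fun x ↦ ?_)
    change Submodule.Quotient.mk (x - c₀ (a₀ x)) = 0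
    rw [Submodule.Quotient.mk_eq_zero, ← hpg', LinearMap.mem_ker, map_sub]
    have h1 : p' (c₀ (a₀ x)) = p (a₀ x) := LinearMap.congr_fun hpc (a₀ x)
    have h2 : p (a₀ x) = p' x := LinearMap.congr_fun hpa x
    rw [h1, h2, sub_self]
  obtain ⟨b, hb⟩ := (cokerMap_factor_iff _ _ hd).1 ⟨0, by rw [hzero, LinearMap.comp_zero]⟩
  refine h.of_retract (isCornerClosed_star hA P₁') (cokerStarMap c₁ c₀ hc) (cokerStarMap a₁ a₀ ha)
    b (LinearMap.range (starMap g')).mkQ fun t ↦ ?_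
  rw [← LinearMap.comp_apply _ b, hb]
  obtain ⟨φ, rfl⟩ := Submodule.Quotient.mk_surjective _ t
  rw [cokerStarMap_mk, cokerStarMap_mk, cokerStarMap_mk, ← Submodule.Quotient.mk_add,
    LinearMap.comp_sub, LinearMap.comp_id, LinearMap.comp_assoc, add_sub_cancel]

/-- If the cokernel of `g*` is corner-closed and `Af` is injective, then the cokernel of `g*` is the
dual of the kernel of `g`: both are corner-closed, and on corner parts this is the exactness of
`Hom_A(-, Af)`. -/
theorem nonempty_cokerStar_equiv {f : A} {hf : IsIdempotentElem f} (hA : IsCornerClosed A hf)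
    (hinj : Module.Injective A (LeftIdealOf f)) (h : IsCornerClosed (CokerStar g) hf)
    {K : Type u} [AddCommGroup K] [Module A K] (k : K →ₗ[A] P₁) (hk : Function.Injective k)
    (hkg : LinearMap.range k = LinearMap.ker g) :
    Nonempty (Star A K ≃ₗ[Aᵐᵒᵖ] CokerStar g) := by
  have hgk : g ∘ₗ k = 0 := LinearMap.ext fun x ↦ by
    have : k x ∈ LinearMap.ker g := hkg ▸ ⟨x, rfl⟩
    exact this
  let F : CokerStar g →ₗ[Aᵐᵒᵖ] Star A K := (LinearMap.range (starMap g)).liftQ (starMap k) (by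
    rintro _ ⟨φ, rfl⟩
    change (φ ∘ₗ g) ∘ₗ k = 0
    rw [LinearMap.comp_assoc, hgk, LinearMap.comp_zero])
  have toIdeal : ∀ {W : Type u} [AddCommGroup W] [Module A W] (φ : Star A W), op f • φ = φ →
      ∃ φ' : W →ₗ[A] LeftIdealOf f, ∀ w, (φ' w : A) = φ w := fun φ hφ ↦
    ⟨φ.codRestrict _ fun w ↦ mem_leftIdeal_of_mul_eq (LinearMap.congr_fun hφ w), fun w ↦ rfl⟩
  have hbij : Function.Bijective (cornerMap hf F) := by
    constructor
    · rw [injective_iff_map_eq_zero]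
      rintro ⟨t, ht⟩ hFt
      obtain ⟨φ₀, rfl⟩ := Submodule.Quotient.mk_surjective _ t
      let φ : Star A P₁ := op f • φ₀
      have hφt : (Submodule.Quotient.mk φ : CokerStar g) = Submodule.Quotient.mk φ₀ := ht
      have hφk : φ ∘ₗ k = 0 := by
        have h1 : F (Submodule.Quotient.mk φ) = 0 := hφt ▸ congrArg Subtype.val hFt
        exact h1
      obtain ⟨φ', hφ'⟩ := toIdeal φ (by rw [smul_smul, ← MulOpposite.op_mul, hf.eq])
      have hker : LinearMap.ker g ≤ LinearMap.ker φ' := fun x hx ↦ by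
        rw [← hkg] at hx
        obtain ⟨y, rfl⟩ := hx
        exact Subtype.ext ((hφ' (k y)).trans (LinearMap.congr_fun hφk y))
      obtain ⟨ψ, hψ⟩ := hinj.out ((LinearMap.ker g).liftQ g le_rfl)
        (LinearMap.ker_eq_bot.1 (Submodule.ker_liftQ_eq_bot _ _ _ le_rfl))
        ((LinearMap.ker g).liftQ φ' hker)
      refine Subtype.ext (hφt.symm.trans ((Submodule.Quotient.mk_eq_zero _).2
        ⟨(Ideal.span {f}).subtype ∘ₗ ψ, LinearMap.ext fun x ↦ ?_⟩))
      exact (congrArg Subtype.val (hψ (Submodule.Quotient.mk x))).trans (hφ' x)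
    · rintro ⟨φ, hφ⟩
      obtain ⟨φ', hφ'⟩ := toIdeal φ hφ
      obtain ⟨ψ, hψ⟩ := hinj.out k hk φ'
      let ψ' : Star A P₁ := (Ideal.span {f}).subtype ∘ₗ ψ
      have hψ' : op f • ψ' = ψ' := LinearMap.ext fun x ↦ mul_idem_eq hf (ψ x)
      refine ⟨⟨Submodule.Quotient.mk ψ', ?_⟩, Subtype.ext (LinearMap.ext fun x ↦ ?_)⟩
      · change op f • _ = _
        rw [← Submodule.Quotient.mk_smul, hψ']
      · exact (congrArg Subtype.val (hψ x)).trans (hφ' x)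
  exact ⟨(LinearEquiv.ofBijective F
    (h.bijective_of_cornerMap (isCornerClosed_star hA K) F hbij)).symm⟩

end Presentation

/-! ### Minimal presentations and perfect modules -/

/-- The injective envelope of a finitely generated module is finitely generated, because it embeds
into `D'(Aⁿ)`. -/
theorem IsInjectiveEnvelope.finite (R : Type u) [CommRing R] [IsArtinianRing R] {A : Type u}
    [Ring A] [Algebra R A] [Module.Finite R A] {X E : Type u} [AddCommGroup X] [Module Aᵐᵒᵖ X]
    [AddCommGroup E] [Module Aᵐᵒᵖ E] {i : X →ₗ[Aᵐᵒᵖ] E} (hi : IsInjectiveEnvelope Aᵐᵒᵖ i)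
    [Module.Finite Aᵐᵒᵖ X] : Module.Finite Aᵐᵒᵖ E := by
  have := finite_opposite R A
  have : IsNoetherianRing Aᵐᵒᵖ := IsNoetherianRing.of_finite R Aᵐᵒᵖ
  have := finite_dual_right (R := R) (A := A) (X := X)
  obtain ⟨n, p, hp⟩ := Module.Finite.exists_fin' A (ArtinDual R A X)
  have := finite_leftDual (R := R) (A := A) (Y := Fin n → A)
  have hQ := injective_leftDual (R := R) (A := A) (Fin n → A)
  obtain ⟨j, hj⟩ := hQ.out i hi.injective (leftDualMap R p ∘ₗ evalRight R X)
  have hjinj : Function.Injective j := by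
    rw [← LinearMap.ker_eq_bot]
    refine hi.essential _ ?_
    rw [Submodule.eq_bot_iff]
    rintro _ ⟨hx, x, rfl⟩
    have h1 : leftDualMap R p (evalRight R X x) = 0 := (hj x).symm.trans hx
    have h2 : x = 0 := evalRight_bijective.1 (leftDualMap_injective p hp
      (h1.trans (by rw [map_zero, map_zero])))
    rw [h2, map_zero]
  exact Module.Finite.of_injective j hjinj

section Perfect

variable (R : Type u) [CommRing R] {A : Type u} [Ring A] [Algebra R A]
variable {X E : Type u} [AddCommGroup X] [Module Aᵐᵒᵖ X] [AddCommGroup E] [Module Aᵐᵒᵖ E]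
variable {f : A} {hf : IsIdempotentElem f}

/-- `D` is exact. -/
theorem range_dualMap_mkQ (i : X →ₗ[Aᵐᵒᵖ] E) :
    LinearMap.range (dualMap R (LinearMap.range i).mkQ) = LinearMap.ker (dualMap R i) := by
  ext φ
  constructor
  · rintro ⟨ψ, rfl⟩
    refine dual_ext fun x ↦ ?_
    change ψ.1 ((LinearMap.range i).mkQ (i x)) = 0
    rw [show (LinearMap.range i).mkQ (i x) = 0 from
      (Submodule.Quotient.mk_eq_zero _).2 ⟨x, rfl⟩, map_zero]
  · intro hφ
    have h : (LinearMap.range i).toAddSubgroup ≤ φ.1.ker := by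
      rintro _ ⟨x, rfl⟩
      exact DFunLike.congr_fun (congrArg Subtype.val hφ) x
    refine ⟨⟨QuotientAddGroup.lift _ φ.1 h, fun r x ↦ ?_⟩, dual_ext fun x ↦ rfl⟩
    obtain ⟨x, rfl⟩ := Submodule.Quotient.mk_surjective _ x
    exact φ.2 r x

/-- A perfect module `X` has a presentation `P₁ → P₀ → D X → 0` for which the cokernel of
`P₀* → P₁*` is corner-closed, being the dual of a left module. -/
theorem IsTauInvPerfect.exists_presentation (hA : IsCornerClosed A hf)
    (hX : IsTauInvPerfect R A X) :
    ∃ (P₁ P₀ : ModuleCat.{u} A) (g : P₁ →ₗ[A] P₀) (p : P₀ →ₗ[A] ArtinDual R A X),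
      Module.Finite A P₁ ∧ Module.Projective A P₁ ∧ Module.Finite A P₀ ∧ Module.Projective A P₀ ∧
      Function.Surjective p ∧ LinearMap.ker p = LinearMap.range g ∧
      IsCornerClosed (CokerStar g) hf := by
  obtain ⟨P₁, P₀, g, p, h, ⟨e⟩⟩ := hX
  refine ⟨P₁, P₀, g, p, h.cover_ker.finite, h.cover_ker.projective, h.cover.finite,
    h.cover.projective, h.cover.surjective, le_antisymm (fun x hx ↦ ?_) ?_,
    (isCornerClosed_star hA _).of_equiv e⟩
  · obtain ⟨y, hy⟩ := h.cover_ker.surjective ⟨x, hx⟩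
    exact ⟨y, congrArg Subtype.val hy⟩
  · rintro _ ⟨x, rfl⟩
    exact h.comp_eq_zero x

variable [IsArtinianRing R] [Module.Finite R A]

/-- `D` turns finitely generated injective modules into projective modules. -/
theorem projective_dual [Module.Finite Aᵐᵒᵖ E] (hE : Module.Injective Aᵐᵒᵖ E) :
    Module.Projective A (ArtinDual R A E) := by
  have := finite_dual_right (R := R) (A := A) (X := E)
  obtain ⟨n, p, hp⟩ := Module.Finite.exists_fin' A (ArtinDual R A E)
  let e := LinearEquiv.ofBijective (evalRight (A := A) R E) evalRight_bijective
  obtain ⟨r, hr⟩ := hE.out (leftDualMap R p ∘ₗ e.toLinearMap)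
    ((leftDualMap_injective p hp).comp e.injective) LinearMap.id
  let e' := LinearEquiv.ofBijective (evalLeft (A := A) R (Fin n → A)) evalLeft_bijective
  refine Module.Projective.of_split (e'.symm.toLinearMap ∘ₗ dualMap R r) p
    (LinearMap.ext fun φ ↦ dual_ext fun x ↦ ?_)
  have h1 : (p (e'.symm (dualMap R r φ))).1 x =
      (e' (e'.symm (dualMap R r φ))).1 (leftDualMap R p (e x)) := rfl
  change (p (e'.symm (dualMap R r φ))).1 x = φ.1 x
  rw [h1, e'.apply_symm_apply, dualMap_apply]
  exact congrArg φ.1 (hr x)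

/-- `D` turns injective envelopes into projective covers. -/
theorem isProjectiveCover_dualMap {i : X →ₗ[Aᵐᵒᵖ] E} (hi : IsInjectiveEnvelope Aᵐᵒᵖ i)
    [Module.Finite Aᵐᵒᵖ X] : IsProjectiveCover A (dualMap R i) := by
  have := hi.finite R
  refine ⟨finite_dual_right, projective_dual R hi.injective_module,
    dualMap_surjective i hi.injective, fun K hK ↦ ?_⟩
  -- The elements of `E` that are killed by `K` form a submodule which does not meet `X`.
  let N : Submodule Aᵐᵒᵖ E :=
    { carrier := {e | ∀ κ ∈ K, κ.1 e = 0}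
      add_mem' := fun {a b} ha hb κ hκ ↦ by rw [map_add, ha κ hκ, hb κ hκ, add_zero]
      zero_mem' := fun κ _ ↦ map_zero κ.1
      smul_mem' := fun a e he κ hκ ↦ he (a.unop • κ) (K.smul_mem _ hκ) }
  have hN : N = ⊥ := by
    refine hi.essential N ?_
    rw [Submodule.eq_bot_iff]
    rintro _ ⟨he, x, rfl⟩
    by_contra hne
    obtain ⟨φ, hφ⟩ := dual_exists_ne_zero (R := R) (A := A) hne
    obtain ⟨κ, hκ, ψ, hψ, rfl⟩ := Submodule.mem_sup.1 (hK ▸ Submodule.mem_top :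
      φ ∈ K ⊔ LinearMap.ker (dualMap R i))
    refine hφ ?_
    have h1 : ψ.1 (i x) = 0 := DFunLike.congr_fun (congrArg Subtype.val hψ) x
    have h2 : κ.1 (i x) = 0 := he κ hκ
    change κ.1 (i x) + ψ.1 (i x) = 0
    rw [h1, h2, add_zero]
  by_contra hne
  obtain ⟨φ, hφ⟩ : ∃ φ, φ ∉ K := by
    by_contra! h
    exact hne ((Submodule.eq_top_iff').2 h)
  have hφ' : K.mkQ φ ≠ 0 := fun h ↦ hφ ((Submodule.Quotient.mk_eq_zero K).1 h)
  obtain ⟨ξ, hξ⟩ := LeftDual.exists_ne_zero (R := R) (A := A) hφ'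
  obtain ⟨e, he⟩ := evalRight_bijective.2 (leftDualMap R K.mkQ ξ)
  have heN : e ∈ N := fun κ hκ ↦ by
    have h1 : (evalRight R E e).1 κ = ξ.1 (K.mkQ κ) := by rw [he, leftDualMap_apply]
    rw [evalRight_apply] at h1
    rw [h1, show K.mkQ κ = 0 from (Submodule.Quotient.mk_eq_zero K).2 hκ, map_zero]
  rw [hN, Submodule.mem_bot] at heN
  refine hξ ?_
  rw [← leftDualMap_apply, ← he, heN, map_zero]
  rfl

/-- If `D X` has a presentation by projectives `g : P₁ → P₀` for which the cokernel of `g*` is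
corner-closed, then `X` is perfect: the minimal presentation of `D X` is the dual of the minimal
injective copresentation of `X`, and the kernel of `D I₁ → D I₀` is `D Ω⁻² X`. -/
theorem isTauInvPerfect_of_presentation (hA : IsCornerClosed A hf)
    (hinj : Module.Injective A (LeftIdealOf f)) [Module.Finite Aᵐᵒᵖ X]
    {P₁ P₀ : Type u} [AddCommGroup P₁] [Module A P₁] [AddCommGroup P₀] [Module A P₀]
    [Module.Finite A P₁] [Module.Projective A P₁] [Module.Finite A P₀] [Module.Projective A P₀]
    (g : P₁ →ₗ[A] P₀) (p : P₀ →ₗ[A] ArtinDual R A X) (hp : Function.Surjective p)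
    (hpg : LinearMap.ker p = LinearMap.range g) (h : IsCornerClosed (CokerStar g) hf) :
    IsTauInvPerfect R A X := by
  let i₀ := toInjectiveEnvelope Aᵐᵒᵖ X
  have hi₀ : IsInjectiveEnvelope Aᵐᵒᵖ i₀ := isInjectiveEnvelope_toInjectiveEnvelope Aᵐᵒᵖ X
  have := hi₀.finite R
  let Ω := injectiveEnvelope Aᵐᵒᵖ X ⧸ LinearMap.range i₀
  let i₁ := toInjectiveEnvelope Aᵐᵒᵖ Ω
  have hi₁ : IsInjectiveEnvelope Aᵐᵒᵖ i₁ := isInjectiveEnvelope_toInjectiveEnvelope Aᵐᵒᵖ Ω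
  have := hi₁.finite R
  let k₀ := dualMap R (LinearMap.range i₀).mkQ
  have hk₀ : Function.Injective k₀ := dualMap_injective _ (Submodule.mkQ_surjective _)
  let k₁ := dualMap R (LinearMap.range i₁).mkQ
  have hk₁ : Function.Injective k₁ := dualMap_injective _ (Submodule.mkQ_surjective _)
  let g' := k₀ ∘ₗ dualMap R i₁
  have hc₀ := isProjectiveCover_dualMap R hi₀
  have hc₁ := isProjectiveCover_dualMap R hi₁
  have hmem : ∀ x, g' x ∈ LinearMap.ker (dualMap R i₀) := fun x ↦
    range_dualMap_mkQ R i₀ ▸ ⟨_, rfl⟩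
  have hker : LinearMap.ker (g'.codRestrict _ hmem) = LinearMap.ker (dualMap R i₁) := by
    rw [LinearMap.ker_codRestrict, LinearMap.ker_comp_of_ker_eq_bot _ (LinearMap.ker_eq_bot.2 hk₀)]
  have hsurj : Function.Surjective (g'.codRestrict _ hmem) := by
    rintro ⟨x, hx⟩
    rw [← range_dualMap_mkQ R i₀] at hx
    obtain ⟨y, rfl⟩ := hx
    obtain ⟨z, rfl⟩ := hc₁.surjective y
    exact ⟨z, rfl⟩
  have hmin : IsMinimalProjectivePresentation A g' (dualMap R i₀) :=
    { cover := hc₀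
      comp_eq_zero := hmem
      cover_ker := ⟨hc₁.finite, hc₁.projective, hsurj, fun K hK ↦ hc₁.superfluous K (hker ▸ hK)⟩ }
  have hpg' : LinearMap.ker (dualMap R i₀) = LinearMap.range g' := by
    rw [← range_dualMap_mkQ R i₀,
      LinearMap.range_comp_of_range_eq_top _ (LinearMap.range_eq_top.2 hc₁.surjective)]
  have := hc₀.finite
  have := hc₀.projective
  have := hc₁.finite
  have := hc₁.projective
  have h' : IsCornerClosed (CokerStar g') hf :=
    IsCornerClosed.of_presentation hA p hp hpg (dualMap R i₀) hc₀.surjective hpg' h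
  have hkg : LinearMap.range k₁ = LinearMap.ker g' := by
    rw [range_dualMap_mkQ R i₁, LinearMap.ker_comp_of_ker_eq_bot _ (LinearMap.ker_eq_bot.2 hk₀)]
  obtain ⟨e⟩ := nonempty_cokerStar_equiv hA hinj h' k₁ hk₁ hkg
  exact ⟨ModuleCat.of A _, ModuleCat.of A _, g', dualMap R i₀, hmin, ⟨e⟩⟩

end Perfect

/-! ### Quotient categories -/

section QuotientCategories

/-- A full and essentially surjective functor exhibits its target as a quotient of its source. -/
theorem isEquivalence_quotientLift {W E : Type*} [Category* W] [Category* E] (r : HomRel W)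
    (F : W ⥤ E) [F.Full] [F.EssSurj]
    (hF : ∀ (x y : W) (a b : x ⟶ y), r a b ↔ F.map a = F.map b) :
    (CategoryTheory.Quotient.lift r F fun x y a b hab ↦ (hF x y a b).1 hab).IsEquivalence := by
  refine { faithful := ⟨?_⟩, full := ⟨?_⟩, essSurj := ⟨fun e ↦ ?_⟩ }
  · rintro ⟨x⟩ ⟨y⟩ ⟨a⟩ ⟨b⟩ hab
    exact CategoryTheory.Quotient.sound r ((hF x y a b).2 hab)
  · rintro ⟨x⟩ ⟨y⟩ c
    obtain ⟨a, ha⟩ := F.map_surjective c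
    exact ⟨(CategoryTheory.Quotient.functor r).map a, ha⟩
  · exact ⟨(CategoryTheory.Quotient.functor r).obj (F.objPreimage e), ⟨F.objObjPreimageIso e⟩⟩

/-- Two full and essentially surjective functors out of the same category that identify the same
maps have equivalent targets. -/
theorem nonempty_equivalence_of_map_eq_iff {W C D : Type*} [Category* W] [Category* C]
    [Category* D] (U : W ⥤ C) (V : W ⥤ D) [U.Full] [U.EssSurj] [V.Full] [V.EssSurj]
    (h : ∀ {x y : W} (a b : x ⟶ y), U.map a = U.map b ↔ V.map a = V.map b) :
    Nonempty (D ≌ C) := by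
  have h1 := isEquivalence_quotientLift U.homRel U fun _ _ _ _ ↦ Iff.rfl
  have h2 := isEquivalence_quotientLift U.homRel V fun _ _ a b ↦ h a b
  exact ⟨(Functor.asEquivalence (CategoryTheory.Quotient.lift U.homRel V _)).symm.trans
    (Functor.asEquivalence (CategoryTheory.Quotient.lift U.homRel U _))⟩

/-- Factoring through a class of finitely generated modules that contains the zero module and is
closed under finite direct sums is a congruence. -/
theorem congruence_factorsThrough {B : Type u} [Ring B] (P : ObjectProperty (FGModuleCat.{u} B))
    (hzero : P (FGModuleCat.of B PUnit))
    (hprod : ∀ Z Z' : FGModuleCat.{u} B, P Z → P Z' → P (FGModuleCat.of B (Z × Z'))) :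
    Congruence (factorsThrough P) where
  comp_left f g g' := by
    rintro ⟨Z, a, b, hZ, h⟩
    exact ⟨Z, f ≫ a, b, hZ, by rw [← Preadditive.comp_sub, h, Category.assoc]⟩
  comp_right g := by
    rintro ⟨Z, a, b, hZ, h⟩
    exact ⟨Z, a, b ≫ g, hZ, by rw [← Preadditive.sub_comp, h, Category.assoc]⟩
  equivalence :=
    { refl := fun f ↦ ⟨_, 0, 0, hzero, by rw [sub_self, Limits.zero_comp]⟩
      symm := by
        rintro f g ⟨Z, a, b, hZ, h⟩
        exact ⟨Z, -a, b, hZ, by rw [Preadditive.neg_comp, ← h, neg_sub]⟩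
      trans := by
        rintro f g k ⟨Z, a, b, hZ, h⟩ ⟨Z', a', b', hZ', h'⟩
        refine ⟨_, ⟨ModuleCat.ofHom (a.hom.hom.prod a'.hom.hom)⟩,
          ⟨ModuleCat.ofHom (b.hom.hom.coprod b'.hom.hom)⟩, hprod Z Z' hZ hZ', ?_⟩
        rw [← sub_add_sub_cancel f g k, h, h']
        refine FGModuleCat.hom_ext (LinearMap.ext fun x ↦ ?_)
        exact (LinearMap.coprod_apply b.hom.hom b'.hom.hom (a.hom.hom x, a'.hom.hom x)).symm }

theorem congruence_addClosure (B : Type u) [Ring B] (M : Type u) [AddCommGroup M] [Module B M] :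
    Congruence (factorsThrough (addClosure B M)) := by
  refine congruence_factorsThrough _ ⟨0, 0, 0, LinearMap.ext fun _ ↦ rfl⟩ ?_
  rintro Z Z' ⟨n, i, r, h⟩ ⟨n', i', r', h'⟩
  let e : (Fin (n + n') → M) ≃ₗ[B] (Fin n → M) × (Fin n' → M) :=
    (LinearEquiv.funCongrLeft B M finSumFinEquiv).trans (LinearEquiv.sumArrowLequivProdArrow _ _ B M)
  refine ⟨n + n', e.symm.toLinearMap ∘ₗ i.prodMap i', r.prodMap r' ∘ₗ e.toLinearMap,
    LinearMap.ext fun x ↦ ?_⟩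
  have h1 : r (i x.1) = x.1 := LinearMap.congr_fun h x.1
  have h2 : r' (i' x.2) = x.2 := LinearMap.congr_fun h' x.2
  change (r.prodMap r') (e (e.symm ((i.prodMap i') x))) = x
  rw [e.apply_symm_apply]
  exact Prod.ext h1 h2

theorem congruence_factorsThroughInjective (B : Type u) [Ring B]
    (𝒞 : ObjectProperty (FGModuleCat.{u} B)) : Congruence (factorsThroughInjective B 𝒞) := by
  have h : Congruence (factorsThrough fun Z : FGModuleCat.{u} B ↦ Module.Injective B Z) := by
    refine congruence_factorsThrough _ ⟨fun X Y _ _ _ _ i hi g ↦ ⟨0, fun x ↦ rfl⟩⟩ ?_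
    intro Z Z' hZ hZ'
    refine ⟨fun X Y _ _ _ _ i hi g ↦ ?_⟩
    obtain ⟨a, ha⟩ := hZ.out i hi (LinearMap.fst B Z Z' ∘ₗ g)
    obtain ⟨b, hb⟩ := hZ'.out i hi (LinearMap.snd B Z Z' ∘ₗ g)
    exact ⟨a.prod b, fun x ↦ Prod.ext (ha x) (hb x)⟩
  exact
    { comp_left := fun f _ _ hg ↦ h.comp_left (𝒞.ι.map f) hg
      comp_right := fun g hf ↦ h.comp_right (𝒞.ι.map g) hf
      equivalence := ⟨fun f ↦ h.equivalence.refl (𝒞.ι.map f), fun hf ↦ h.equivalence.symm hf,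
        fun hf hg ↦ h.equivalence.trans hf hg⟩ }

end QuotientCategories

/-! ### The category of presentations -/

section Presentations

variable {A : Type u} [Ring A] {f : A}

/-- A presentation `g : P₁ → P₀` by finitely generated projective left modules such that the
cokernel of `g*` is corner-closed. -/
structure ClosedPresentation (hf : IsIdempotentElem f) : Type (u + 1) where
  /-- The source of the presentation. -/
  P₁ : ModuleCat.{u} A
  /-- The target of the presentation. -/
  P₀ : ModuleCat.{u} A
  /-- The map of the presentation. -/
  g : P₁ →ₗ[A] P₀
  finite₁ : Module.Finite A P₁
  projective₁ : Module.Projective A P₁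
  finite₀ : Module.Finite A P₀
  projective₀ : Module.Projective A P₀
  closed : IsCornerClosed (CokerStar g) hf

namespace ClosedPresentation

variable {hf : IsIdempotentElem f}

attribute [instance] finite₁ projective₁ finite₀ projective₀

/-- Maps from `w` to `w'` are commutative squares from `w'` to `w`, so that both functors from
presentations to right modules are covariant. -/
@[ext]
structure Hom (w w' : ClosedPresentation hf) : Type u where
  /-- The map between the sources. -/
  a₁ : w'.P₁ →ₗ[A] w.P₁
  /-- The map between the targets. -/
  a₀ : w'.P₀ →ₗ[A] w.P₀
  comm : w.g ∘ₗ a₁ = a₀ ∘ₗ w'.g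

instance : Category.{u} (ClosedPresentation hf) where
  Hom := Hom
  id w := ⟨LinearMap.id, LinearMap.id, rfl⟩
  comp a b := ⟨a.a₁ ∘ₗ b.a₁, a.a₀ ∘ₗ b.a₀, comp_square a.comm b.comm⟩

theorem sub_comm {w w' : ClosedPresentation hf} (a b : w ⟶ w') :
    w.g ∘ₗ (a.a₁ - b.a₁) = (a.a₀ - b.a₀) ∘ₗ w'.g := by
  rw [LinearMap.comp_sub, LinearMap.sub_comp, a.comm, b.comm]

theorem cokerMap_sub {w w' : ClosedPresentation hf} (a b : w ⟶ w') :
    cokerMap _ _ (sub_comm a b) = cokerMap a.a₁ a.a₀ a.comm - cokerMap b.a₁ b.a₀ b.comm :=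
  Submodule.linearMap_qext _ (LinearMap.ext fun _ ↦ rfl)

theorem cokerStarMap_sub {w w' : ClosedPresentation hf} (a b : w ⟶ w') :
    cokerStarMap _ _ (sub_comm a b) =
      cokerStarMap a.a₁ a.a₀ a.comm - cokerStarMap b.a₁ b.a₀ b.comm :=
  Submodule.linearMap_qext _ (LinearMap.ext fun φ ↦
    congrArg Submodule.Quotient.mk (LinearMap.comp_sub b.a₁ a.a₁ φ))

end ClosedPresentation

open ClosedPresentation

/-- Every finitely generated right module is the cokernel of `g*` for a map `g` of finitely
generated free left modules. -/
theorem exists_cokerStar_equiv [IsNoetherianRing Aᵐᵒᵖ] (T : Type u) [AddCommGroup T]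
    [Module Aᵐᵒᵖ T] [Module.Finite Aᵐᵒᵖ T] :
    ∃ (n m : ℕ) (g : (Fin n → A) →ₗ[A] (Fin m → A)), Nonempty (CokerStar g ≃ₗ[Aᵐᵒᵖ] T) := by
  obtain ⟨n, t, ht⟩ := Module.Finite.exists_fin (R := Aᵐᵒᵖ) (M := T)
  let ev : Star A (Fin n → A) →ₗ[Aᵐᵒᵖ] (Fin n → Aᵐᵒᵖ) :=
    { toFun := fun φ i ↦ op (φ (Pi.single i 1))
      map_add' := fun _ _ ↦ rfl
      map_smul' := fun _ _ ↦ rfl }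
  let p : Star A (Fin n → A) →ₗ[Aᵐᵒᵖ] T := Fintype.linearCombination Aᵐᵒᵖ t ∘ₗ ev
  have hp : Function.Surjective p := fun y ↦ by
    obtain ⟨c, rfl⟩ := (Submodule.mem_span_range_iff_exists_fun Aᵐᵒᵖ).1
      (ht ▸ Submodule.mem_top : y ∈ Submodule.span Aᵐᵒᵖ (Set.range t))
    refine ⟨Fintype.linearCombination A fun i ↦ (c i).unop, ?_⟩
    change ∑ i, op (Fintype.linearCombination A (fun i ↦ (c i).unop) (Pi.single i 1)) • t i = _
    refine Finset.sum_congr rfl fun i _ ↦ congrArg (fun a : Aᵐᵒᵖ ↦ a • t i) ?_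
    rw [Fintype.linearCombination_apply_single, one_smul, op_unop]
  have := finite_star A (Fin n → A)
  obtain ⟨m, κ, hκ⟩ := Submodule.fg_iff_exists_fin_generating_family.1
    (IsNoetherian.noetherian (LinearMap.ker p))
  refine ⟨n, m, LinearMap.pi κ, ⟨(Submodule.quotEquivOfEq _ _ ?_).trans
    (p.quotKerEquivOfSurjective hp)⟩⟩
  have hsum : ∀ φ : Star A (Fin m → A),
      starMap (LinearMap.pi κ) φ = ∑ j, op (φ (Pi.single j 1)) • κ j := fun φ ↦ by
    refine LinearMap.ext fun x ↦ ?_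
    rw [LinearMap.sum_apply]
    change φ (fun j ↦ κ j x) = _
    rw [← Finset.univ_sum_single (fun j ↦ κ j x), map_sum]
    refine Finset.sum_congr rfl fun j _ ↦ ?_
    rw [star_smul_apply, ← smul_eq_mul, ← map_smul, ← Pi.single_smul, smul_eq_mul, mul_one]
  rw [← hκ]
  apply le_antisymm
  · rintro _ ⟨φ, rfl⟩
    rw [hsum]
    exact Submodule.sum_mem _ fun j _ ↦
      Submodule.smul_mem _ _ (Submodule.subset_span ⟨j, rfl⟩)
  · rw [Submodule.span_le]
    rintro _ ⟨j, rfl⟩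
    exact ⟨LinearMap.proj j, rfl⟩

variable (R : Type u) [CommRing R] [IsArtinianRing R] [Algebra R A] [Module.Finite R A]
variable (hf : IsIdempotentElem f)

/-- The functor taking a presentation `g` to the right `fAf`-module `coker(g*) f`. -/
def toCornerModule : ClosedPresentation hf ⥤ FGModuleCat.{u} (hf.Corner)ᵐᵒᵖ where
  obj w := ⟨ModuleCat.of _ (CornerPart f (CokerStar w.g)),
    have := finite_star A w.P₁
    finite_cornerPart R hf (CokerStar w.g)⟩
  map a := ObjectProperty.homMk (ModuleCat.ofHom (cornerMap hf (cokerStarMap a.a₁ a.a₀ a.comm)))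
  map_id w := FGModuleCat.hom_ext (congrArg (cornerMap hf) (cokerStarMap_id w.g))
  map_comp a b := FGModuleCat.hom_ext (congrArg (cornerMap hf) (cokerStarMap_comp a.comm b.comm))

instance : (toCornerModule R hf).Full where
  map_surjective {w w'} ψ := by
    obtain ⟨F, hF⟩ := w'.closed.exists_cornerMap_eq ψ.hom.hom
    have := projective_star A w.P₁
    have := projective_star A w.P₀
    obtain ⟨b₀, b₁, hb, hFb⟩ := exists_lift_presentation (g := starMap w'.g) (g' := starMap w.g)
      (LinearMap.range (starMap w'.g)).mkQ (Submodule.mkQ_surjective _) (Submodule.ker_mkQ _)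
      (LinearMap.range (starMap w.g)).mkQ (Submodule.ker_mkQ _).ge F
    obtain ⟨a₀, rfl⟩ := exists_starMap_eq b₀
    obtain ⟨a₁, rfl⟩ := exists_starMap_eq b₁
    refine ⟨⟨a₁, a₀, starMap_injective hb.symm⟩, FGModuleCat.hom_ext ?_⟩
    rw [← hF]
    exact congrArg (cornerMap hf) (Submodule.linearMap_qext _ hFb)

instance : (toCornerModule R hf).EssSurj where
  mem_essImage N := by
    have := finite_opposite R A
    have : IsNoetherianRing Aᵐᵒᵖ := IsNoetherianRing.of_finite R Aᵐᵒᵖ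
    have := finite_homIdeal R hf N
    obtain ⟨n, m, g, ⟨e⟩⟩ := exists_cokerStar_equiv (A := A) (HomIdeal hf N)
    let w : ClosedPresentation hf :=
      { P₁ := ModuleCat.of A (Fin n → A)
        P₀ := ModuleCat.of A (Fin m → A)
        g := g
        finite₁ := inferInstanceAs (Module.Finite A (Fin n → A))
        projective₁ := inferInstanceAs (Module.Projective A (Fin n → A))
        finite₀ := inferInstanceAs (Module.Finite A (Fin m → A))
        projective₀ := inferInstanceAs (Module.Projective A (Fin m → A))
        closed := (isCornerClosed_homIdeal hf N).of_equiv e.symm }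
    let e' : CornerPart f (CokerStar g) ≃ₗ[(hf.Corner)ᵐᵒᵖ] CornerPart f (HomIdeal hf N) :=
      LinearEquiv.ofLinearMap (cornerMap hf e.toLinearMap) (cornerMap hf e.symm.toLinearMap)
        (LinearMap.ext fun t ↦ Subtype.ext (e.apply_symm_apply t.1))
        (LinearMap.ext fun t ↦ Subtype.ext (e.symm_apply_apply t.1))
    exact ⟨w, ⟨ObjectProperty.isoMk _ (e'.trans (homIdealCornerEquiv hf N)).toModuleIso⟩⟩

instance (Y : Type u) [AddCommGroup Y] [Module A Y] [Module.Finite A Y] :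
    Module.Finite Aᵐᵒᵖ (LeftDual R A Y) := finite_leftDual

/-- The functor taking a presentation `g` to the right `A`-module `D'(coker g)`. -/
def toDualCoker : ClosedPresentation hf ⥤ FGModuleCat.{u} Aᵐᵒᵖ where
  obj w := FGModuleCat.of Aᵐᵒᵖ (LeftDual R A (Coker w.g))
  map a := ObjectProperty.homMk (ModuleCat.ofHom (leftDualMap R (cokerMap a.a₁ a.a₀ a.comm)))
  map_id w := FGModuleCat.hom_ext (congrArg (leftDualMap R) (cokerMap_id w.g))
  map_comp a b := FGModuleCat.hom_ext (congrArg (leftDualMap R) (cokerMap_comp a.comm b.comm))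

instance : (toDualCoker R hf).Full where
  map_surjective {w w'} F := by
    obtain ⟨v, hv⟩ := exists_leftDualMap_eq (R := R) (A := A) F.hom.hom
    obtain ⟨a₁, a₀, ha, hva⟩ := exists_lift_presentation (g := w.g) (g' := w'.g)
      (LinearMap.range w.g).mkQ (Submodule.mkQ_surjective _) (Submodule.ker_mkQ _)
      (LinearMap.range w'.g).mkQ (Submodule.ker_mkQ _).ge v
    refine ⟨⟨a₁, a₀, ha⟩, FGModuleCat.hom_ext ?_⟩
    rw [← hv]
    exact congrArg (leftDualMap R) (Submodule.linearMap_qext _ hva)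

end Presentations

/-! ### Comparison of the two quotient categories -/

section Comparison

open ClosedPresentation

variable (R : Type u) [CommRing R] {A : Type u} [Ring A] [Algebra R A]
  [Module.Finite R A] {f : A} {hf : IsIdempotentElem f}

/-- Two maps of presentations agree modulo `add(Af)` after applying `toCornerModule` if and only if
the induced map on the cokernels of the duals factors through the projection onto its target. -/
theorem factorsThrough_addClosure_iff (hA : IsCornerClosed A hf) {w w' : ClosedPresentation hf}
    (a b : w ⟶ w') :
    factorsThrough (addClosure (hf.Corner)ᵐᵒᵖ (LeftIdealOf f)) ((toCornerModule R hf).map a)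
      ((toCornerModule R hf).map b) ↔
    ∃ c : CokerStar w.g →ₗ[Aᵐᵒᵖ] Star A w'.P₁,
      (LinearMap.range (starMap w'.g)).mkQ ∘ₗ c = cokerStarMap _ _ (sub_comm a b) := by
  constructor
  · rintro ⟨Z, x, y, ⟨n, i, r, hir⟩, h⟩
    refine exists_lift_of_cornerMap_eq hA w'.closed _ (i ∘ₗ x.hom.hom) (y.hom.hom ∘ₗ r) ?_ _
      (Submodule.mkQ_surjective _)
    have h1 : cornerMap hf (cokerStarMap _ _ (sub_comm a b)) = y.hom.hom ∘ₗ x.hom.hom := by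
      rw [cokerStarMap_sub]
      exact congrArg (fun k ↦ k.hom.hom) h
    rw [h1]
    refine LinearMap.ext fun t ↦ ?_
    exact congrArg y.hom.hom (LinearMap.congr_fun hir (x.hom.hom t)).symm
  · rintro ⟨c, hc⟩
    have := finite_star A w'.P₁
    obtain ⟨n, hn⟩ := isDirectSummandOf_cornerPart_star hf w'.P₁
    refine ⟨⟨ModuleCat.of _ (CornerPart f (Star A w'.P₁)), finite_cornerPart R hf _⟩,
      ObjectProperty.homMk (ModuleCat.ofHom (cornerMap hf c)), ObjectProperty.homMk
        (ModuleCat.ofHom (cornerMap hf (LinearMap.range (starMap w'.g)).mkQ)), ⟨n, hn⟩, ?_⟩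
    rw [cokerStarMap_sub] at hc
    exact FGModuleCat.hom_ext (congrArg (cornerMap hf) hc.symm)

variable [IsArtinianRing R]

/-- Two maps of presentations agree modulo injective modules after applying `toDualCoker` if and
only if the induced map of cokernels factors through the projection onto its target. -/
theorem factorsThrough_injective_iff {w w' : ClosedPresentation hf} (a b : w ⟶ w') :
    factorsThrough (fun Z : FGModuleCat.{u} Aᵐᵒᵖ ↦ Module.Injective Aᵐᵒᵖ Z)
      ((toDualCoker R hf).map a) ((toDualCoker R hf).map b) ↔
    ∃ e : Coker w'.g →ₗ[A] w.P₀,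
      (LinearMap.range w.g).mkQ ∘ₗ e = cokerMap _ _ (sub_comm a b) := by
  have hsub : leftDualMap R (cokerMap _ _ (sub_comm a b)) =
      leftDualMap R (cokerMap a.a₁ a.a₀ a.comm) - leftDualMap R (cokerMap b.a₁ b.a₀ b.comm) := by
    rw [cokerMap_sub]
    exact LinearMap.ext fun φ ↦ leftDual_ext fun z ↦ map_sub φ.1 _ _
  constructor
  · rintro ⟨Z, x, y, hZ, h⟩
    -- The map into an injective module extends along `D'(coker g) → D'(P₀)`.
    obtain ⟨x', hx'⟩ := hZ.out (leftDualMap R (LinearMap.range w.g).mkQ)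
      (leftDualMap_injective _ (Submodule.mkQ_surjective _)) x.hom.hom
    obtain ⟨e, he⟩ := exists_leftDualMap_eq (R := R) (A := A) (Y := w.P₀) (y.hom.hom ∘ₗ x')
    refine ⟨e, (leftDualMap_inj (R := R)).1 ?_⟩
    rw [hsub]
    refine Eq.trans (LinearMap.ext fun φ ↦ ?_) (congrArg (fun k ↦ k.hom.hom) h).symm
    change leftDualMap R e (leftDualMap R (LinearMap.range w.g).mkQ φ) = y.hom.hom (x.hom.hom φ)
    rw [he]
    exact congrArg y.hom.hom (hx' φ)
  · rintro ⟨e, he⟩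
    refine ⟨FGModuleCat.of Aᵐᵒᵖ (LeftDual R A w.P₀),
      ObjectProperty.homMk (ModuleCat.ofHom (leftDualMap R (LinearMap.range w.g).mkQ)),
      ObjectProperty.homMk (ModuleCat.ofHom (leftDualMap R e)), injective_leftDual _, ?_⟩
    exact FGModuleCat.hom_ext (hsub.symm.trans (congrArg (leftDualMap R) he.symm))

theorem perTauInv_toDualCoker (hA : IsCornerClosed A hf)
    (hinj : Module.Injective A (LeftIdealOf f)) (w : ClosedPresentation hf) :
    perTauInv R A ((toDualCoker R hf).obj w) := by
  have hker : LinearMap.ker (evalLeft R (Coker w.g) ∘ₗ (LinearMap.range w.g).mkQ) =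
      LinearMap.range w.g := by
    rw [LinearMap.ker_comp_of_ker_eq_bot _ (LinearMap.ker_eq_bot.2 evalLeft_bijective.1),
      Submodule.ker_mkQ]
  have h : IsTauInvPerfect R A (LeftDual R A (Coker w.g)) :=
    isTauInvPerfect_of_presentation R hA hinj w.g _
      (evalLeft_bijective.2.comp (Submodule.mkQ_surjective _)) hker w.closed
  exact h

/-- The functor from presentations to perfect modules. -/
def toPerfect (hA : IsCornerClosed A hf) (hinj : Module.Injective A (LeftIdealOf f)) :
    ClosedPresentation hf ⥤ (perTauInv R A).FullSubcategory :=
  (perTauInv R A).lift (toDualCoker R hf) (perTauInv_toDualCoker R hA hinj)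

theorem full_toPerfect (hA : IsCornerClosed A hf) (hinj : Module.Injective A (LeftIdealOf f)) :
    (toPerfect R hA hinj).Full :=
  inferInstanceAs ((perTauInv R A).lift (toDualCoker R hf) _).Full

theorem essSurj_toPerfect (hA : IsCornerClosed A hf) (hinj : Module.Injective A (LeftIdealOf f)) :
    (toPerfect R hA hinj).EssSurj where
  mem_essImage X := by
    have hX : IsTauInvPerfect R A X.obj := X.property
    obtain ⟨P₁, P₀, g, p, h1, h2, h3, h4, hp, hpg, hclosed⟩ := hX.exists_presentation R hA
    let w : ClosedPresentation hf := ⟨P₁, P₀, g, h1, h2, h3, h4, hclosed⟩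
    let e : Coker g ≃ₗ[A] ArtinDual R A X.obj :=
      (Submodule.quotEquivOfEq _ _ hpg.symm).trans (p.quotKerEquivOfSurjective hp)
    let e' : LeftDual R A (ArtinDual R A X.obj) ≃ₗ[Aᵐᵒᵖ] LeftDual R A (Coker g) :=
      LinearEquiv.ofLinearMap (leftDualMap R e.toLinearMap) (leftDualMap R e.symm.toLinearMap)
        (LinearMap.ext fun φ ↦ leftDual_ext fun z ↦ congrArg φ.1 (e.symm_apply_apply z))
        (LinearMap.ext fun φ ↦ leftDual_ext fun z ↦ congrArg φ.1 (e.apply_symm_apply z))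
    let e'' := LinearEquiv.ofBijective (evalRight (A := A) R X.obj) evalRight_bijective
    exact ⟨w, ⟨ObjectProperty.isoMk _ (ObjectProperty.isoMk _ (e''.trans e').symm.toModuleIso)⟩⟩

end Comparison

end ArtinAlg

end

theorem mainTheorem6 (R : Type u) [CommRing R] [IsArtinianRing R]
    (A : Type u) [Ring A] [Algebra R A] [Module.Finite R A]
    (f : A) (hf : IsIdempotentElem f)
    (hproj : Module.Projective A (ArtinAlg.LeftIdealOf f))
    (hinj : Module.Injective A (ArtinAlg.LeftIdealOf f))
    (hmin : ArtinAlg.IsMinimalFaithful A (ArtinAlg.LeftIdealOf f))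
    (hdom : 2 ≤ ArtinAlg.dominantDimension Aᵐᵒᵖ A) :
    Nonempty
      (ArtinAlg.ModuloObjects (FGModuleCat.{u} (hf.Corner)ᵐᵒᵖ)
          (ArtinAlg.addClosure (hf.Corner)ᵐᵒᵖ (ArtinAlg.LeftIdealOf f)) ≌
        ArtinAlg.CostableCategory Aᵐᵒᵖ (ArtinAlg.perTauInv R A)) := by
  have := hmin.1
  have hE : Module.Projective Aᵐᵒᵖ (ArtinAlg.minimalInjectiveTerm Aᵐᵒᵖ A 1) := by
    by_contra hcon
    have h1 : ArtinAlg.dominantDimension Aᵐᵒᵖ A ≤ (1 : ℕ) := sInf_le ⟨1, rfl, hcon⟩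
    exact absurd (hdom.trans h1) (by decide)
  have hA := ArtinAlg.isCornerClosed_self R hf hE
  have := ArtinAlg.full_toPerfect R hA hinj
  have := ArtinAlg.essSurj_toPerfect R hA hinj
  have := ArtinAlg.congruence_addClosure (hf.Corner)ᵐᵒᵖ (ArtinAlg.LeftIdealOf f)
  have := ArtinAlg.congruence_factorsThroughInjective Aᵐᵒᵖ (ArtinAlg.perTauInv R A)
  refine ArtinAlg.nonempty_equivalence_of_map_eq_iff
    (ArtinAlg.toPerfect R hA hinj ⋙ CategoryTheory.Quotient.functor _)
    (ArtinAlg.toCornerModule R hf ⋙ CategoryTheory.Quotient.functor _) fun {w w'} a b ↦ ?_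
  rw [Functor.comp_map, Functor.comp_map, Functor.comp_map, Functor.comp_map,
    CategoryTheory.Quotient.functor_map_eq_iff, CategoryTheory.Quotient.functor_map_eq_iff,
    ArtinAlg.factorsThrough_addClosure_iff R hA a b]
  refine (ArtinAlg.factorsThrough_injective_iff R a b).trans ?_
  exact ArtinAlg.cokerMap_factor_iff _ _ _
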